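/- Conventions. Let $\mathbb K\in\{\mathbb R,\mathbb C\}$. A Lie group is a group which is a smooth manifold modeled on a (Hausdorff) locally convex $\mathbb K$-space, with smooth multiplication and inversion; a map between open subsets of locally convex spaces is $C^1$ if it is continuous, all directional derivatives $df(x)(h)$ exist and $df$ is continuous, it is $C^{n+1}$ if it is $C^1$ and $df$ is $C^{n}$, and it is smooth if it is $C^n$ for all $n$. Let $G$, $N$ be Lie groups and $Z(N)$ the center of $N$; $C_N(n)(m)=nmn^{-1}$. $C^1_s(G,N)$ is the set of maps $f:G\to N$ with $f(1)=1$ that are smooth on an identity neighborhood; $C^2_s(G,N)$ is the set of maps $\omega:G\times G\to N$ with $\omega(g,1)=\omega(1,g)=1$ that are smooth on an identity neighborhood; $C^2_{ss}(G,N)$ is the set of those $\omega\in C^2_s(G,N)$ for which, for every $g\in G$, the map $x\mapsto\omega(g,x)\,\omega(gxg^{-1},g)^{-1}$ is smooth on an identity neighborhood. $C^1_s(G,\mathrm{Aut}(N))$ is the set of maps $S:G\to\mathrm{Aut}(N)$ into the Lie group automorphisms of $N$ with $S(1)=\mathrm{id}_N$ such that $(g,n)\mapsto S(g)(n)$ is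 smooth on $U\times N$ for some identity neighborhood $U$. Such an $S$ is a smooth outer action if $S(g)S(g')S(gg')^{-1}=C_N(\omega(g,g'))$ for some $\omega\in C^2_s(G,N)$; $S\sim S'$ means $S'(g)=C_N(h(g))S(g)$ for some $h\in C^1_s(G,N)$, and the classes $[S]$ are the smooth $G$-kernels. For $\beta:G\times G\to Z(N)$ and $\alpha:G\to Z(N)$ put $(d_S\beta)(g,g',g'')=S(g)(\beta(g',g''))\,\beta(g,g'g'')\,\beta(gg',g'')^{-1}\beta(g,g')^{-1}$ and $(d_S\alpha)(g,g')=S(g)(\alpha(g'))\,\alpha(gg')^{-1}\alpha(g)$. Let $Z^2_{ss}(G,Z(N))_{[S]}$ be the group of $Z(N)$-valued $\beta\in C^2_{ss}(G,N)$ with $d_S\beta=1$, $B^2_s(G,Z(N))_{[S]}$ the group of all $d_S\alpha$ with $\alpha\in C^1_s(G,N)$ $Z(N)$-valued, and $H^2_{ss}(G,Z(N))_{[S]}=Z^2_{ss}(G,Z(N))_{[S]}/B^2_s(G,Z(N))_{[S]}$; these depend only on $[S]$. An extension of $G$ by $N$ is a short exact sequence $1\to N\xrightarrow{\iota}\widehat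 G\xrightarrow{q}G\to1$ of Lie group morphisms for which $\widehat G$ is a smooth principal $N$-bundle over $G$; two extensions are equivalent if there is a Lie group morphism between the total groups inducing the identity on $N$ and on $G$; $\mathrm{Ext}(G,N)$ is the set of equivalence classes. An extension corresponds to $[S]$ if, for a section $\sigma$ of $q$ with $\sigma(1)=1$, smooth on an identity neighborhood, the map $S'$ defined by $\iota(S'(g)(n))=\sigma(g)\iota(n)\sigma(g)^{-1}$ satisfies $S'\sim S$; $\mathrm{Ext}(G,N)_{[S]}$ is the set of classes of such extensions. A smooth factor system is a pair $(S,\omega)$ with $S\in C^1_s(G,\mathrm{Aut}(N))$, $\omega\in C^2_{ss}(G,N)$, $S(g)S(g')S(gg')^{-1}=C_N(\omega(g,g'))$ and $S(g)(\omega(g',g''))\,\omega(g,g'g'')=\omega(g,g')\,\omega(gg',g'')$. Then $N\times_{(S,\omega)}G$ is the set $N\times G$ with the multiplication $(n,g)(n',g')=(n\,S(g)(n')\,\omega(g,g'),gg')$, with a Lie group structure making $N\to N\times_{(S,\omega)}G\to G$ an extension of Lie groups and for which $N\times G\to N\times_{(S,\omega)}G$, $(n,g)\mapsto(n,g)$,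 is smooth on $N\times U$ for some open identity neighborhood $U\subseteq G$. Statement. Let $S$ be a smooth outer action of $G$ on $N$ with $\mathrm{Ext}(G,N)_{[S]}\neq\emptyset$. Then: (0) For every smooth factor system $(S',\omega)$ with $S'\sim S$, the extension $N\times_{(S',\omega)}G$ exists and defines exactly one class $[N\times_{(S',\omega)}G]$, which belongs to $\mathrm{Ext}(G,N)_{[S]}$. (1) Every class in $\mathrm{Ext}(G,N)_{[S]}$ is of the form $[N\times_{(S,\omega)}G]$ for a smooth factor system $(S,\omega)$. If $(S,\omega)$ and $(S,\omega')$ are smooth factor systems, then $\omega'\omega^{-1}\in Z^2_{ss}(G,Z(N))_{[S]}$, and $N\times_{(S,\omega)}G$ and $N\times_{(S,\omega')}G$ are equivalent extensions if and only if $\omega'\omega^{-1}\in B^2_s(G,Z(N))_{[S]}$. (2) The assignment $$[\beta]\cdot[N\times_{(S',\omega)}G]=[N\times_{(S',\omega\cdot\beta)}G]$$ (for smooth factor systems $(S',\omega)$ with $S'\sim S$ and $\beta\in Z^2_{ss}(G,Z(N))_{[S]}$) is a well-defined simply transitive action of the group $H^2_{ss}(G,Z(N))_{[S]}$ on $\mathrm{Ext}(G,N)_{[S]}$.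 -/

import Mathlib

open Filter Topology Set

universe w u v

namespace NonabelianExt

section Calculus

variable {𝕜 : Type*} [RCLike 𝕜]

/-- `y` is the derivative of `f` at `x` in the direction `h`. -/
def HasDirDeriv (𝕜 : Type*) [RCLike 𝕜] {X Y : Type*} [AddCommGroup X] [Module 𝕜 X]
    [AddCommGroup Y] [Module 𝕜 Y] [TopologicalSpace Y] (f : X → Y) (x h : X) (y : Y) : Prop :=
  Tendsto (fun t : 𝕜 => t⁻¹ • (f (x + t • h) - f x)) (𝓝[≠] 0) (𝓝 y)

/-- `f` is of class `C^n` on the open set `U`: it is continuous on `U` and, for `n + 1`, all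
directional derivatives exist on `U` and `df : U × X → Y` is of class `C^n`. -/
def CnOn (𝕜 : Type*) [RCLike 𝕜] : ∀ (_ : ℕ) {X Y : Type _} [AddCommGroup X] [Module 𝕜 X]
    [TopologicalSpace X] [AddCommGroup Y] [Module 𝕜 Y] [TopologicalSpace Y],
    (X → Y) → Set X → Prop
  | 0, _, _, _, _, _, _, _, _, f, U => ContinuousOn f U
  | n + 1, X, Y, _, _, _, _, _, _, f, U => ContinuousOn f U ∧
      ∃ df : X × X → Y, (∀ x ∈ U, ∀ h, HasDirDeriv 𝕜 f x h (df (x, h))) ∧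
        CnOn 𝕜 n df (U ×ˢ univ)

/-- `f` is smooth on the open set `U`. -/
def SmoothOnOpen (𝕜 : Type*) [RCLike 𝕜] {X Y : Type*} [AddCommGroup X] [Module 𝕜 X]
    [TopologicalSpace X] [AddCommGroup Y] [Module 𝕜 Y] [TopologicalSpace Y]
    (f : X → Y) (U : Set X) : Prop :=
  ∀ n, CnOn 𝕜 n f U

end Calculus

section CalculusLemmas

variable {𝕜 : Type*} [RCLike 𝕜]

section basic

variable {X Y Z : Type*} [AddCommGroup X] [Module 𝕜 X] [TopologicalSpace X]
  [AddCommGroup Y] [Module 𝕜 Y] [TopologicalSpace Y]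
  [AddCommGroup Z] [Module 𝕜 Z] [TopologicalSpace Z]

theorem CnOn.continuousOn {n : ℕ} {f : X → Y} {U : Set X} (h : CnOn 𝕜 n f U) :
    ContinuousOn f U := by
  cases n with
  | zero => exact h
  | succ n => exact h.1

end basic

theorem CnOn.of_succ {n : ℕ} : ∀ {X : Type*} {Y : Type*} [AddCommGroup X] [Module 𝕜 X]
    [TopologicalSpace X] [AddCommGroup Y] [Module 𝕜 Y] [TopologicalSpace Y]
    {f : X → Y} {U : Set X}, CnOn 𝕜 (n + 1) f U → CnOn 𝕜 n f U := by
  induction n with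
  | zero => intro X Y _ _ _ _ _ _ f U h; exact h.1
  | succ n ih =>
    intro X Y _ _ _ _ _ _ f U h
    obtain ⟨hc, df, h1, h2⟩ := h
    exact ⟨hc, df, h1, ih h2⟩

theorem CnOn.mono {n : ℕ} : ∀ {X : Type*} {Y : Type*} [AddCommGroup X] [Module 𝕜 X]
    [TopologicalSpace X] [AddCommGroup Y] [Module 𝕜 Y] [TopologicalSpace Y]
    {f : X → Y} {U V : Set X}, CnOn 𝕜 n f U → V ⊆ U → CnOn 𝕜 n f V := by
  induction n with
  | zero => intro X Y _ _ _ _ _ _ f U V h hV; exact ContinuousOn.mono h hV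
  | succ n ih =>
    intro X Y _ _ _ _ _ _ f U V h hV
    obtain ⟨hc, df, h1, h2⟩ := h
    exact ⟨hc.mono hV, df, fun x hx => h1 x (hV hx), ih h2 (prod_mono hV subset_rfl)⟩

theorem CnOn.comp_clm {n : ℕ} : ∀ {X : Type*} {Y : Type*} {Z : Type*}
    [AddCommGroup X] [Module 𝕜 X]
    [TopologicalSpace X] [AddCommGroup Y] [Module 𝕜 Y] [TopologicalSpace Y]
    [AddCommGroup Z] [Module 𝕜 Z] [TopologicalSpace Z]
    {f : Y → Z} {U : Set Y} (A : X →L[𝕜] Y), CnOn 𝕜 n f U → CnOn 𝕜 n (f ∘ A) (A ⁻¹' U) := by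
  induction n with
  | zero =>
    intro X Y Z _ _ _ _ _ _ _ _ _ f U A h
    exact ContinuousOn.comp h A.continuous.continuousOn (mapsTo_preimage _ _)
  | succ n ih =>
    intro X Y Z _ _ _ _ _ _ _ _ _ f U A h
    obtain ⟨hc, df, h1, h2⟩ := h
    refine ⟨ContinuousOn.comp hc A.continuous.continuousOn (mapsTo_preimage _ _),
      df ∘ (A.prodMap A), fun x hx h => ?_, ?_⟩
    · have := h1 (A x) hx (A h)
      simpa [HasDirDeriv] using this
    · exact (ih (A.prodMap A) h2).mono (fun p hp => ⟨hp.1, trivial⟩)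

theorem cnOn_clm {n : ℕ} : ∀ {X : Type*} {Y : Type*} [AddCommGroup X] [Module 𝕜 X]
    [TopologicalSpace X] [AddCommGroup Y] [Module 𝕜 Y] [TopologicalSpace Y]
    (A : X →L[𝕜] Y) (U : Set X), CnOn 𝕜 n A U := by
  induction n with
  | zero => intro X Y _ _ _ _ _ _ A U; exact A.continuous.continuousOn
  | succ n ih =>
    intro X Y _ _ _ _ _ _ A U
    refine ⟨A.continuous.continuousOn, A ∘L ContinuousLinearMap.snd 𝕜 X X, fun x _ h => ?_,
      ih _ _⟩
    refine tendsto_nhds_of_eventually_eq ?_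
    filter_upwards [self_mem_nhdsWithin] with t ht
    have ht : t ≠ 0 := ht
    simp [smul_smul, ht]

theorem cnOn_const {n : ℕ} : ∀ {X : Type*} {Y : Type*} [AddCommGroup X] [Module 𝕜 X]
    [TopologicalSpace X] [AddCommGroup Y] [Module 𝕜 Y] [TopologicalSpace Y]
    (c : Y) (U : Set X), CnOn 𝕜 n (fun _ : X => c) U := by
  induction n with
  | zero => intro X Y _ _ _ _ _ _ c U; exact continuousOn_const
  | succ n ih =>
    intro X Y _ _ _ _ _ _ c U
    refine ⟨continuousOn_const, fun _ => 0, fun x _ h => ?_, ih _ _⟩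
    simp [HasDirDeriv, tendsto_const_nhds]

theorem CnOn.prodMk {n : ℕ} : ∀ {X : Type*} {Y : Type*} {Z : Type*}
    [AddCommGroup X] [Module 𝕜 X]
    [TopologicalSpace X] [AddCommGroup Y] [Module 𝕜 Y] [TopologicalSpace Y]
    [AddCommGroup Z] [Module 𝕜 Z] [TopologicalSpace Z]
    {f : X → Y} {g : X → Z} {U : Set X}, CnOn 𝕜 n f U → CnOn 𝕜 n g U →
    CnOn 𝕜 n (fun x => (f x, g x)) U := by
  induction n with
  | zero =>
    intro X Y Z _ _ _ _ _ _ _ _ _ f g U hf hg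
    exact ContinuousOn.prodMk hf hg
  | succ n ih =>
    intro X Y Z _ _ _ _ _ _ _ _ _ f g U hf hg
    obtain ⟨hfc, df, f1, f2⟩ := hf
    obtain ⟨hgc, dg, g1, g2⟩ := hg
    refine ⟨hfc.prodMk hgc, fun p => (df p, dg p), fun x hx h => ?_, ih f2 g2⟩
    exact (f1 x hx h).prodMk_nhds (g1 x hx h)

theorem CnOn.congr {n : ℕ} {X Y : Type*} [AddCommGroup X] [Module 𝕜 X]
    [TopologicalSpace X] [AddCommGroup Y] [Module 𝕜 Y] [TopologicalSpace Y]
    [IsTopologicalAddGroup X] [ContinuousSMul 𝕜 X]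
    {f g : X → Y} {U : Set X} (hU : IsOpen U) (hf : CnOn 𝕜 n f U) (h : EqOn g f U) :
    CnOn 𝕜 n g U := by
  cases n with
  | zero => exact ContinuousOn.congr hf h
  | succ n =>
    obtain ⟨hc, df, h1, h2⟩ := hf
    refine ⟨hc.congr h, df, fun x hx v => (h1 x hx v).congr' ?_, h2⟩
    have : Tendsto (fun t : 𝕜 => x + t • v) (𝓝[≠] 0) (𝓝 x) := by
      have : Continuous (fun t : 𝕜 => x + t • v) := by fun_prop
      have := this.tendsto 0
      simp only [zero_smul, add_zero] at this
      exact this.mono_left nhdsWithin_le_nhds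
    filter_upwards [this (hU.mem_nhds hx)] with t ht
    rw [h hx, h ht]

/-- In a locally convex space, difference quotients of `C^1` maps converge along convergent
directions. -/
theorem tendsto_slope {Y Z : Type*} [AddCommGroup Y] [Module 𝕜 Y]
    [TopologicalSpace Y] [IsTopologicalAddGroup Y] [ContinuousSMul 𝕜 Y]
    [AddCommGroup Z] [Module 𝕜 Z] [TopologicalSpace Z] [IsTopologicalAddGroup Z]
    [ContinuousSMul 𝕜 Z] [PolynormableSpace 𝕜 Z]
    {g : Y → Z} {dg : Y × Y → Z} {V : Set Y} (hV : IsOpen V)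
    (hd : ∀ y ∈ V, ∀ h, HasDirDeriv 𝕜 g y h (dg (y, h)))
    (hc : ContinuousOn dg (V ×ˢ univ)) {y : Y} (hy : y ∈ V) {v : 𝕜 → Y} {v0 : Y}
    (hv : Tendsto v (𝓝[≠] 0) (𝓝 v0)) :
    Tendsto (fun t : 𝕜 => t⁻¹ • (g (y + t • v t) - g y)) (𝓝[≠] 0) (𝓝 (dg (y, v0))) := by
  let _ : Module ℝ Z := Module.compHom Z (algebraMap ℝ 𝕜)
  have : IsScalarTower ℝ 𝕜 Z := ⟨fun r a z => by
    rw [Algebra.smul_def, mul_smul]; rfl⟩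
  have hsm : ∀ (r : ℝ) (z : Z), r • z = (r : 𝕜) • z := fun r z => rfl
  have hws := PolynormableSpace.withSeminorms 𝕜 Z
  have : LocallyConvexSpace ℝ Z := hws.toLocallyConvexSpace
  have : ContinuousSMul ℝ Z := IsScalarTower.continuousSMul (M := ℝ) (α := Z) 𝕜
  have hbasis := (closed_nhds_basis (dg (y, v0)))
  rw [hbasis.tendsto_right_iff]
  rintro K ⟨hK, hKc⟩
  obtain ⟨C, ⟨hC, hCconv⟩, hCK⟩ := (LocallyConvexSpace.convex_basis (𝕜 := ℝ) (dg (y, v0))).mem_iff.1 hK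
  simp only [id] at hCK
  -- neighbourhoods on which the derivative stays in `C`
  have hcat : ContinuousAt dg (y, v0) :=
    hc.continuousAt ((hV.prod isOpen_univ).mem_nhds ⟨hy, trivial⟩)
  have h1 : ∀ᶠ p in 𝓝 (y, v0), dg p ∈ C ∧ p.1 ∈ V :=
    (hcat.eventually_mem hC).and (continuousAt_fst.eventually_mem (hV.mem_nhds hy))
  rw [nhds_prod_eq, eventually_prod_iff] at h1
  obtain ⟨pa, hpa, pb, hpb, hab⟩ := h1
  have hpa' : ∀ᶠ w in 𝓝 (0 : Y), pa (y + w) := by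
    have : Tendsto (fun w => y + w) (𝓝 (0 : Y)) (𝓝 y) := by
      have : Continuous (fun w => y + w) := by fun_prop
      simpa using this.tendsto 0
    exact this hpa
  obtain ⟨D, ⟨hD, hDb⟩, hDs⟩ := (nhds_basis_balanced 𝕜 Y).mem_iff.1 hpa'
  simp only [id] at hDs
  have htv : Tendsto (fun t : 𝕜 => t • v t) (𝓝[≠] 0) (𝓝 0) := by
    have : Tendsto (fun t : 𝕜 => t) (𝓝[≠] 0) (𝓝 0) := nhdsWithin_le_nhds
    simpa using this.smul hv
  filter_upwards [htv hD, hv hpb, self_mem_nhdsWithin] with t htD htb ht0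
  have ht0 : t ≠ 0 := ht0
  by_contra hnot
  have hCcl : closure C ⊆ K := closure_minimal hCK hKc
  obtain ⟨l, u, hl, hu⟩ := RCLike.geometric_hahn_banach_closed_point (𝕜 := 𝕜)
    hCconv.closure isClosed_closure (fun h => hnot (hCcl h))
  have hmem : ∀ s ∈ Icc (0 : ℝ) 1, pa (y + (s : 𝕜) • (t • v t)) := by
    intro s hs
    apply hDs
    refine hDb.smul_mem ?_ htD
    simp [abs_le]; constructor <;> linarith [hs.1, hs.2]
  let ψ : ℝ → ℝ := fun s => RCLike.re (l (t⁻¹ • (g (y + (s : 𝕜) • (t • v t)))))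
  have hder : ∀ s ∈ Icc (0 : ℝ) 1,
      HasDerivAt ψ (RCLike.re (l (dg (y + (s : 𝕜) • (t • v t), v t)))) s := by
    intro s hs
    rw [hasDerivAt_iff_tendsto_slope_zero]
    have hxV := (hab (hmem s hs) htb).2
    have h2 := hd _ hxV (v t)
    have h3 : Tendsto (fun r : ℝ => (r : 𝕜) * t) (𝓝[≠] 0) (𝓝[≠] 0) := by
      refine tendsto_nhdsWithin_iff.2 ⟨?_, ?_⟩
      · have : Continuous (fun r : ℝ => (r : 𝕜) * t) :=
          (RCLike.continuous_ofReal).mul continuous_const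
        have := this.tendsto 0
        simp only [RCLike.ofReal_zero, zero_mul] at this
        exact this.mono_left nhdsWithin_le_nhds
      · filter_upwards [self_mem_nhdsWithin] with r hr
        have hr : r ≠ 0 := hr
        simp [hr, ht0]
    have h4 := ((RCLike.continuous_re.comp l.continuous).tendsto _).comp (h2.comp h3)
    refine h4.congr fun r => ?_
    simp only [Function.comp_apply, ψ, smul_eq_mul]
    have e1 : (((r : 𝕜) * t)⁻¹) = ((r⁻¹ : ℝ) : 𝕜) * t⁻¹ := by
      rw [mul_inv]; simp
    have e2 : y + (s : 𝕜) • t • v t + ((r : 𝕜) * t) • v t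
        = y + ((s + r : ℝ) : 𝕜) • t • v t := by
      simp only [RCLike.ofReal_add]; module
    rw [← map_sub, ← map_sub, ← smul_sub, ← RCLike.re_ofReal_mul, ← smul_eq_mul (_ : 𝕜) (l _),
      ← map_smul]
    rw [e1, e2, mul_smul]
  obtain ⟨ξ, hξ, hslope⟩ := exists_hasDerivAt_eq_slope ψ
    (fun s => RCLike.re (l (dg (y + (s : 𝕜) • (t • v t), v t)))) zero_lt_one
    (fun s hs => (hder s hs).continuousAt.continuousWithinAt)
    (fun s hs => hder s (Ioo_subset_Icc_self hs))
  have h5 := hl _ (subset_closure (hab (hmem ξ (Ioo_subset_Icc_self hξ)) htb).1)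
  simp only [sub_zero, div_one] at hslope
  rw [hslope] at h5
  simp only [ψ, RCLike.ofReal_one, one_smul, RCLike.ofReal_zero, zero_smul, add_zero] at h5
  rw [← map_sub, ← map_sub, ← smul_sub] at h5
  exact absurd h5 (not_lt.2 hu.le)

theorem CnOn.comp {n : ℕ} : ∀ {X : Type*} {Y : Type*} {Z : Type*}
    [AddCommGroup X] [Module 𝕜 X] [TopologicalSpace X]
    [AddCommGroup Y] [Module 𝕜 Y] [TopologicalSpace Y]
    [IsTopologicalAddGroup Y] [ContinuousSMul 𝕜 Y]
    [AddCommGroup Z] [Module 𝕜 Z] [TopologicalSpace Z] [IsTopologicalAddGroup Z]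
    [ContinuousSMul 𝕜 Z] [PolynormableSpace 𝕜 Z]
    {g : Y → Z} {f : X → Y} {V : Set Y} {U : Set X}, IsOpen V → CnOn 𝕜 n g V → CnOn 𝕜 n f U →
    MapsTo f U V → CnOn 𝕜 n (g ∘ f) U := by
  induction n with
  | zero =>
    intro X Y Z _ _ _ _ _ _ _ _ _ _ _ _ _ _ g f V U hV hg hf hm
    exact ContinuousOn.comp hg hf hm
  | succ n ih =>
    intro X Y Z _ _ _ _ _ _ _ _ _ _ _ _ _ _ g f V U hV hg hf hm
    have hfn := hf.of_succ
    obtain ⟨hfc, df, f1, f2⟩ := hf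
    obtain ⟨hgc, dg, g1, g2⟩ := hg
    refine ⟨hgc.comp hfc hm, dg ∘ (fun p : X × X => (f p.1, df p)), fun x hx h => ?_, ?_⟩
    · have := tendsto_slope hV g1 g2.continuousOn (hm hx) (f1 x hx h)
      refine this.congr' ?_
      filter_upwards [self_mem_nhdsWithin] with t ht
      have ht : t ≠ 0 := ht
      simp [smul_smul, ht]
    · refine ih (hV.prod isOpen_univ) g2 (CnOn.prodMk ?_ f2) fun p hp => ⟨hm hp.1, trivial⟩
      exact (hfn.comp_clm (ContinuousLinearMap.fst 𝕜 X X)).mono fun p hp => hp.1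

end CalculusLemmas

section Manifold

/-- The product of two charted spaces, with the products of charts as atlas. -/
instance prodChart (E M F M' : Type*) [TopologicalSpace E] [TopologicalSpace M]
    [ChartedSpace E M] [TopologicalSpace F] [TopologicalSpace M'] [ChartedSpace F M'] :
    ChartedSpace (E × F) (M × M') where
  atlas := image2 OpenPartialHomeomorph.prod (atlas E M) (atlas F M')
  chartAt x := (chartAt E x.1).prod (chartAt F x.2)
  mem_chart_source x := ⟨mem_chart_source E x.1, mem_chart_source F x.2⟩
  chart_mem_atlas x := mem_image2_of_mem (chart_mem_atlas E x.1) (chart_mem_atlas F x.2)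

variable (𝕜 : Type*) [RCLike 𝕜]

/-- `M`, with its charts in the locally convex space `E`, is a smooth manifold: all changes of
charts are smooth. -/
class SmoothManifold (E : Type*) [AddCommGroup E] [Module 𝕜 E] [TopologicalSpace E]
    (M : Type*) [TopologicalSpace M] [ChartedSpace E M] : Prop where
  compatible : ∀ e ∈ atlas E M, ∀ e' ∈ atlas E M,
    SmoothOnOpen 𝕜 (e' ∘ e.symm) (e.target ∩ e.symm ⁻¹' e'.source)

section

variable (E F : Type*) [AddCommGroup E] [Module 𝕜 E] [TopologicalSpace E]
  [AddCommGroup F] [Module 𝕜 F] [TopologicalSpace F]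
  {M M' : Type*} [TopologicalSpace M] [ChartedSpace E M] [TopologicalSpace M'] [ChartedSpace F M']

/-- `f : M → M'` is smooth near `x`: in suitable charts of the two manifolds, `f` is smooth on an
open neighbourhood of the point corresponding to `x`. -/
def SmoothNear (f : M → M') (x : M) : Prop :=
  ∃ e ∈ atlas E M, ∃ e' ∈ atlas F M', x ∈ e.source ∧ ∃ O : Set E, IsOpen O ∧ O ⊆ e.target ∧
    e x ∈ O ∧ MapsTo (f ∘ e.symm) O e'.source ∧ SmoothOnOpen 𝕜 (e' ∘ f ∘ e.symm) O

/-- `f` is smooth on the open set `U`. -/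
def SmoothOnSet (f : M → M') (U : Set M) : Prop := ∀ x ∈ U, SmoothNear 𝕜 E F f x

/-- `f` is smooth. -/
def SmoothMap (f : M → M') : Prop := ∀ x, SmoothNear 𝕜 E F f x

/-- `f` is smooth on some open neighbourhood of `x`. -/
def LocallySmoothAt (f : M → M') (x : M) : Prop :=
  ∃ U : Set M, IsOpen U ∧ x ∈ U ∧ SmoothOnSet 𝕜 E F f U

end

section Lemmas

variable {𝕜}
variable {E F H : Type*} [AddCommGroup E] [Module 𝕜 E] [TopologicalSpace E]
  [AddCommGroup F] [Module 𝕜 F] [TopologicalSpace F]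
  [AddCommGroup H] [Module 𝕜 H] [TopologicalSpace H]
  {M M' M'' : Type*} [TopologicalSpace M] [ChartedSpace E M] [TopologicalSpace M']
  [ChartedSpace F M'] [TopologicalSpace M''] [ChartedSpace H M'']

theorem SmoothNear.eventually {f : M → M'} {x : M} (h : SmoothNear 𝕜 E F f x) :
    ∃ U : Set M, IsOpen U ∧ x ∈ U ∧ SmoothOnSet 𝕜 E F f U := by
  obtain ⟨e, he, e', he', hx, O, hO, hOt, hxO, hm, hs⟩ := h
  refine ⟨e.source ∩ e ⁻¹' O, e.isOpen_inter_preimage hO, ⟨hx, hxO⟩, fun y hy => ?_⟩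
  exact ⟨e, he, e', he', hy.1, O, hO, hOt, hy.2, hm, hs⟩

theorem locallySmoothAt_iff {f : M → M'} {x : M} :
    LocallySmoothAt 𝕜 E F f x ↔ SmoothNear 𝕜 E F f x :=
  ⟨fun ⟨_, _, hx, h⟩ => h x hx, fun h => h.eventually⟩

theorem SmoothNear.continuousAt {f : M → M'} {x : M} (h : SmoothNear 𝕜 E F f x) :
    ContinuousAt f x := by
  obtain ⟨e, he, e', he', hx, O, hO, hOt, hxO, hm, hs⟩ := h
  have h1 : ContinuousAt (e' ∘ f ∘ e.symm) (e x) :=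
    ((hs 0).continuousOn).continuousAt (hO.mem_nhds hxO)
  have h2 : f x ∈ e'.source := by simpa [hx] using hm hxO
  have h3 : ContinuousAt e'.symm ((e' ∘ f ∘ e.symm) (e x)) := by
    apply e'.continuousAt_symm
    simpa [hx] using e'.map_source h2
  have h4 : ContinuousAt ((e'.symm ∘ (e' ∘ f ∘ e.symm)) ∘ e) x :=
    (ContinuousAt.comp h3 h1).comp (e.continuousAt hx)
  refine h4.congr ?_
  filter_upwards [(e.isOpen_inter_preimage hO).mem_nhds ⟨hx, hxO⟩] with y hy
  have := hm hy.2
  simp only [Function.comp_apply, e.left_inv hy.1] at this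
  simp [e.left_inv hy.1, e'.left_inv this]

theorem SmoothNear.congr [IsTopologicalAddGroup E] [ContinuousSMul 𝕜 E] {f g : M → M'} {x : M}
    (h : SmoothNear 𝕜 E F f x) (hfg : f =ᶠ[𝓝 x] g) : SmoothNear 𝕜 E F g x := by
  obtain ⟨e, he, e', he', hx, O, hO, hOt, hxO, hm, hs⟩ := h
  obtain ⟨W, hW, hWo, hxW⟩ := mem_nhds_iff.1 hfg
  have hO' : IsOpen (e.target ∩ e.symm ⁻¹' W) := e.isOpen_inter_preimage_symm hWo
  have heq : ∀ u ∈ e.target ∩ e.symm ⁻¹' W, f (e.symm u) = g (e.symm u) := fun u hu => hW hu.2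
  refine ⟨e, he, e', he', hx, O ∩ (e.target ∩ e.symm ⁻¹' W), hO.inter hO',
    inter_subset_left.trans hOt, ⟨hxO, e.map_source hx, by simpa [hx] using hxW⟩, ?_, fun n => ?_⟩
  · intro u hu
    have := hm hu.1
    simpa [heq u hu.2] using this
  · refine ((hs n).mono inter_subset_left).congr (hO.inter hO') fun u hu => ?_
    simp [heq u hu.2]

theorem SmoothNear.comp [IsTopologicalAddGroup E] [ContinuousSMul 𝕜 E]
    [IsTopologicalAddGroup F] [ContinuousSMul 𝕜 F]
    [IsTopologicalAddGroup H] [ContinuousSMul 𝕜 H] [PolynormableSpace 𝕜 H]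
    [SmoothManifold 𝕜 F M'] {g : M' → M''} {f : M → M'} {x : M}
    (hg : SmoothNear 𝕜 F H g (f x)) (hf : SmoothNear 𝕜 E F f x) :
    SmoothNear 𝕜 E H (fun y => g (f y)) x := by
  obtain ⟨e, he, e', he', hx, O, hO, hOt, hxO, hm, hs⟩ := hf
  obtain ⟨d, hd, d', hd', hy, P, hP, hPt, hyP, hm', hs'⟩ := hg
  have hfx : f x ∈ e'.source := by simpa [hx] using hm hxO
  have htr := SmoothManifold.compatible (𝕜 := 𝕜) e' he' d hd
  have hTo : IsOpen (e'.target ∩ e'.symm ⁻¹' d.source) := e'.isOpen_inter_preimage_symm d.open_source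
  have hT1 := ((htr 0).continuousOn).isOpen_inter_preimage hTo hP
  have hg1 := fun n => (hs' n).comp hP ((htr n).mono inter_subset_left) fun u hu => hu.2
  have hO1 := ((hs 0).continuousOn).isOpen_inter_preimage hO hT1
  have key : ∀ u ∈ O, e'.symm (e' (f (e.symm u))) = f (e.symm u) := fun u hu => e'.left_inv (hm hu)
  refine ⟨e, he, d', hd', hx, _, hO1, inter_subset_left.trans hOt,
    ⟨hxO, ⟨?_, ?_⟩, ?_⟩, ?_, fun n => ?_⟩
  · simpa [hx] using e'.map_source hfx
  · simpa [hx, hfx] using hy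
  · simpa [hx, hfx] using hyP
  · intro u hu
    have h1 := hm' hu.2.2
    have h2 : f (e.symm u) ∈ d.source := by simpa [key u hu.1] using hu.2.1.2
    simpa [key u hu.1, h2] using h1
  · have := (hg1 n).comp hT1 ((hs n).mono inter_subset_left) (fun u hu => hu.2)
    refine this.congr hO1 fun u hu => ?_
    have h2 : f (e.symm u) ∈ d.source := by simpa [key u hu.1] using hu.2.1.2
    simp [key u hu.1, h2]

/-- Smoothness near a point can be tested in any chart of the source. -/
theorem SmoothNear.exists_chart [IsTopologicalAddGroup E] [ContinuousSMul 𝕜 E]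
    [IsTopologicalAddGroup F] [ContinuousSMul 𝕜 F] [PolynormableSpace 𝕜 F]
    [SmoothManifold 𝕜 E M] {f : M → M'} {x : M} (hf : SmoothNear 𝕜 E F f x)
    {e : OpenPartialHomeomorph M E} (he : e ∈ atlas E M) (hx : x ∈ e.source) :
    ∃ e' ∈ atlas F M', ∃ O : Set E, IsOpen O ∧ O ⊆ e.target ∧
      e x ∈ O ∧ MapsTo (f ∘ e.symm) O e'.source ∧ SmoothOnOpen 𝕜 (e' ∘ f ∘ e.symm) O := by
  obtain ⟨d, hd, e', he', hxd, O, hO, hOt, hxO, hm, hs⟩ := hf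
  have htr := SmoothManifold.compatible (𝕜 := 𝕜) e he d hd
  have hTo : IsOpen (e.target ∩ e.symm ⁻¹' d.source) := e.isOpen_inter_preimage_symm d.open_source
  have hT1 := ((htr 0).continuousOn).isOpen_inter_preimage hTo hO
  refine ⟨e', he', _, hT1, inter_subset_left.trans inter_subset_left,
    ⟨⟨e.map_source hx, by simpa [hx] using hxd⟩, by simpa [hx] using hxO⟩, fun u hu => ?_,
    fun n => ?_⟩
  · have h := hm hu.2
    have h2 : e.symm u ∈ d.source := hu.1.2
    simpa [h2] using h
  · refine ((hs n).comp hO ((htr n).mono inter_subset_left) (fun u hu => hu.2)).congr hT1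
      fun u hu => ?_
    have h2 : e.symm u ∈ d.source := hu.1.2
    simp [h2]

theorem SmoothNear.prodMk [IsTopologicalAddGroup E] [ContinuousSMul 𝕜 E]
    [IsTopologicalAddGroup F] [ContinuousSMul 𝕜 F] [PolynormableSpace 𝕜 F]
    [IsTopologicalAddGroup H] [ContinuousSMul 𝕜 H] [PolynormableSpace 𝕜 H]
    [SmoothManifold 𝕜 E M] {f : M → M'} {g : M → M''} {x : M}
    (hf : SmoothNear 𝕜 E F f x) (hg : SmoothNear 𝕜 E H g x) :
    SmoothNear 𝕜 E (F × H) (fun y => (f y, g y)) x := by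
  obtain ⟨e, he, e', he', hx, O, hO, hOt, hxO, hm, hs⟩ := hf
  obtain ⟨d', hd', P, hP, hPt, hxP, hm', hs'⟩ := hg.exists_chart he hx
  exact ⟨e, he, e'.prod d', mem_image2_of_mem he' hd', hx, O ∩ P, hO.inter hP,
    inter_subset_left.trans hOt, ⟨hxO, hxP⟩, fun u hu => ⟨hm hu.1, hm' hu.2⟩, fun n =>
    ((hs n).mono inter_subset_left).prodMk ((hs' n).mono inter_subset_right)⟩

theorem SmoothNear.id [IsTopologicalAddGroup E] [ContinuousSMul 𝕜 E] (x : M) :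
    SmoothNear 𝕜 E E (fun y : M => y) x := by
  refine ⟨chartAt E x, chart_mem_atlas E x, chartAt E x, chart_mem_atlas E x,
    mem_chart_source E x, (chartAt E x).target, (chartAt E x).open_target,
    subset_rfl, mem_chart_target E x, fun u hu => (chartAt E x).map_target hu, fun n => ?_⟩
  refine (cnOn_clm (ContinuousLinearMap.id 𝕜 E) _).congr (chartAt E x).open_target fun u hu => ?_
  exact (chartAt E x).right_inv hu

theorem SmoothNear.const (c : M') (x : M) : SmoothNear 𝕜 E F (fun _ : M => c) x := by
  refine ⟨chartAt E x, chart_mem_atlas E x, chartAt F c, chart_mem_atlas F c,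
    mem_chart_source E x, (chartAt E x).target, (chartAt E x).open_target, subset_rfl,
    mem_chart_target E x, fun u hu => mem_chart_source F c, fun n => ?_⟩
  exact cnOn_const (chartAt F c c) _

theorem SmoothNear.fst [IsTopologicalAddGroup E] [ContinuousSMul 𝕜 E]
    [IsTopologicalAddGroup F] [ContinuousSMul 𝕜 F] (p : M × M') :
    SmoothNear 𝕜 (E × F) E (Prod.fst : M × M' → M) p := by
  refine ⟨chartAt (E × F) p, chart_mem_atlas _ p, chartAt E p.1, chart_mem_atlas E p.1,
    mem_chart_source _ p, (chartAt (E × F) p).target, (chartAt (E × F) p).open_target, subset_rfl,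
    mem_chart_target _ p, fun u hu => ?_, fun n => ?_⟩
  · exact ((chartAt (E × F) p).map_target hu).1
  · refine (cnOn_clm (ContinuousLinearMap.fst 𝕜 E F) _).congr (chartAt (E × F) p).open_target
      fun u hu => ?_
    exact ((chartAt E p.1).right_inv hu.1)

theorem SmoothNear.snd [IsTopologicalAddGroup E] [ContinuousSMul 𝕜 E]
    [IsTopologicalAddGroup F] [ContinuousSMul 𝕜 F] (p : M × M') :
    SmoothNear 𝕜 (E × F) F (Prod.snd : M × M' → M') p := by
  refine ⟨chartAt (E × F) p, chart_mem_atlas _ p, chartAt F p.2, chart_mem_atlas F p.2,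
    mem_chart_source _ p, (chartAt (E × F) p).target, (chartAt (E × F) p).open_target, subset_rfl,
    mem_chart_target _ p, fun u hu => ?_, fun n => ?_⟩
  · exact ((chartAt (E × F) p).map_target hu).2
  · refine (cnOn_clm (ContinuousLinearMap.snd 𝕜 E F) _).congr (chartAt (E × F) p).open_target
      fun u hu => ?_
    exact ((chartAt F p.2).right_inv hu.2)

instance SmoothManifold.prod [SmoothManifold 𝕜 E M] [SmoothManifold 𝕜 F M'] :
    SmoothManifold 𝕜 (E × F) (M × M') where
  compatible := by
    rintro _ ⟨e, he, d, hd, rfl⟩ _ ⟨e', he', d', hd', rfl⟩ n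
    have h1 := (SmoothManifold.compatible (𝕜 := 𝕜) e he e' he' n).comp_clm
      (ContinuousLinearMap.fst 𝕜 E F)
    have h2 := (SmoothManifold.compatible (𝕜 := 𝕜) d hd d' hd' n).comp_clm
      (ContinuousLinearMap.snd 𝕜 E F)
    refine (h1.mono ?_).prodMk (h2.mono ?_)
    · exact fun p hp => ⟨hp.1.1, hp.2.1⟩
    · exact fun p hp => ⟨hp.1.2, hp.2.2⟩

end Lemmas
end Manifold

section LieGroups

/-- A Lie group modelled on the locally convex space `E` over `𝕜`. -/
class LocConvLieGroup (𝕜 : Type*) [RCLike 𝕜] (E : Type*) [AddCommGroup E] [Module 𝕜 E]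
    [TopologicalSpace E] (G : Type*) [Group G] [TopologicalSpace G] [ChartedSpace E G] : Prop
    extends SmoothManifold 𝕜 E G where
  smooth_mul : SmoothMap 𝕜 (E × E) E (fun p : G × G => p.1 * p.2)
  smooth_inv : SmoothMap 𝕜 E E (fun g : G => g⁻¹)

section Lemmas

set_option linter.unusedSectionVars false

variable {𝕜 : Type*} [RCLike 𝕜]
  {E : Type*} [AddCommGroup E] [Module 𝕜 E] [TopologicalSpace E] [IsTopologicalAddGroup E]
  [ContinuousSMul 𝕜 E]
  {M : Type*} [TopologicalSpace M] [ChartedSpace E M] [SmoothManifold 𝕜 E M]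
  {F : Type*} [AddCommGroup F] [Module 𝕜 F] [TopologicalSpace F] [IsTopologicalAddGroup F]
  [ContinuousSMul 𝕜 F] [PolynormableSpace 𝕜 F]
  {H : Type*} [Group H] [TopologicalSpace H] [ChartedSpace F H] [LocConvLieGroup 𝕜 F H]

theorem SmoothNear.mul {f g : M → H} {x : M}
    (hf : SmoothNear 𝕜 E F f x) (hg : SmoothNear 𝕜 E F g x) :
    SmoothNear 𝕜 E F (fun y => f y * g y) x :=
  SmoothNear.comp (F := F × F) (g := fun p : H × H => p.1 * p.2) (f := fun y => (f y, g y))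
    (LocConvLieGroup.smooth_mul (𝕜 := 𝕜) (E := F) (f x, g x)) (hf.prodMk hg)

theorem SmoothNear.inv {f : M → H} {x : M} (hf : SmoothNear 𝕜 E F f x) :
    SmoothNear 𝕜 E F (fun y => (f y)⁻¹) x :=
  SmoothNear.comp (F := F) (g := fun p : H => p⁻¹) (LocConvLieGroup.smooth_inv (𝕜 := 𝕜) (E := F) (f x)) hf

end Lemmas

end LieGroups

section Algebra

variable {G N : Type*} [Group G] [Group N]

/-- `δ_S(g, g') = S(g) S(g') S(gg')⁻¹`. -/
def deltaAut (S : G → MulAut N) (g g' : G) : MulAut N := S g * S g' * (S (g * g'))⁻¹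

/-- `(d_S ω)(g, g', g'') = S(g)(ω(g', g'')) ω(g, g'g'') ω(gg', g'')⁻¹ ω(g, g')⁻¹`. -/
def d2 (S : G → MulAut N) (ω : G × G → N) (g g' g'' : G) : N :=
  S g (ω (g', g'')) * ω (g, g' * g'') * (ω (g * g', g''))⁻¹ * (ω (g, g'))⁻¹

/-- `(d_S α)(g, g') = S(g)(α(g')) α(gg')⁻¹ α(g)`. -/
def d1 (S : G → MulAut N) (α : G → N) (g g' : G) : N :=
  S g (α g') * (α (g * g'))⁻¹ * α g

theorem map_center (φ : MulAut N) {z : N} (hz : z ∈ Subgroup.center N) :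
    φ z ∈ Subgroup.center N := by
  rw [Subgroup.mem_center_iff] at *
  intro n
  obtain ⟨m, rfl⟩ := φ.surjective n
  rw [← map_mul, hz, map_mul]

instance centerCommGroup : CommGroup (Subgroup.center N) :=
  { (inferInstance : Group (Subgroup.center N)) with
    mul_comm := fun a b => Subtype.ext (Subgroup.mem_center_iff.1 b.2 a) }

/-- `S(g)`, restricted to the centre. -/
def centerMap (φ : MulAut N) : Subgroup.center N →* Subgroup.center N :=
  (φ.toMonoidHom.comp (Subgroup.center N).subtype).codRestrict (Subgroup.center N)
    fun z => map_center φ z.2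

end Algebra

section Cochains

variable (𝕜 : Type*) [RCLike 𝕜]
  (EG : Type*) [AddCommGroup EG] [Module 𝕜 EG] [TopologicalSpace EG]
  {G : Type*} [Group G] [TopologicalSpace G] [ChartedSpace EG G]
  (EN : Type*) [AddCommGroup EN] [Module 𝕜 EN] [TopologicalSpace EN]
  {N : Type*} [Group N] [TopologicalSpace N] [ChartedSpace EN N]

/-- `f ∈ C¹_s(G, N)`: `f` is normalized and smooth on an open identity neighbourhood. -/
def IsC1 (f : G → N) : Prop := f 1 = 1 ∧ LocallySmoothAt 𝕜 EG EN f 1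

/-- `ω ∈ C²_s(G, N)`. -/
def IsC2 (ω : G × G → N) : Prop :=
  (∀ g, ω (g, 1) = 1) ∧ (∀ g, ω (1, g) = 1) ∧ LocallySmoothAt 𝕜 (EG × EG) EN ω 1

/-- `ω ∈ C²_ss(G, N)`: moreover every `ω_g(x) = ω(g, x) ω(g x g⁻¹, g)⁻¹` is smooth on an open
identity neighbourhood. -/
def IsC2ss (ω : G × G → N) : Prop :=
  IsC2 𝕜 EG EN ω ∧
    ∀ g : G, LocallySmoothAt 𝕜 EG EN (fun x => ω (g, x) * (ω (g * x * g⁻¹, g))⁻¹) 1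

/-- `φ` is an automorphism of the Lie group `N`. -/
def IsLieAut (φ : MulAut N) : Prop := SmoothMap 𝕜 EN EN φ ∧ SmoothMap 𝕜 EN EN φ.symm

/-- `S ∈ C¹_s(G, Aut(N))`. -/
structure IsC1Aut (S : G → MulAut N) : Prop where
  lieAut : ∀ g, IsLieAut 𝕜 EN (S g)
  map_one : S 1 = 1
  locallySmooth : ∃ U : Set G, IsOpen U ∧ 1 ∈ U ∧
    SmoothOnSet 𝕜 (EG × EN) EN (fun p : G × N => S p.1 p.2) (U ×ˢ univ)

/-- `S` is a smooth outer action of `G` on `N`. -/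
def IsSmoothOuterAction (S : G → MulAut N) : Prop :=
  IsC1Aut 𝕜 EG EN S ∧
    ∃ ω : G × G → N, IsC2 𝕜 EG EN ω ∧ ∀ g g', deltaAut S g g' = MulAut.conj (ω (g, g'))

/-- The equivalence `S ∼ S'` of smooth outer actions; its classes are the smooth `G`-kernels. -/
def OuterEquiv (S S' : G → MulAut N) : Prop :=
  ∃ h : G → N, IsC1 𝕜 EG EN h ∧ ∀ g, S' g = MulAut.conj (h g) * S g

end Cochains

section Cohomology

set_option linter.unusedSectionVars false

variable (𝕜 : Type*) [RCLike 𝕜]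
  (EG : Type*) [AddCommGroup EG] [Module 𝕜 EG] [TopologicalSpace EG] [IsTopologicalAddGroup EG]
  [ContinuousSMul 𝕜 EG]
  {G : Type*} [Group G] [TopologicalSpace G] [ChartedSpace EG G] [LocConvLieGroup 𝕜 EG G]
  (EN : Type*) [AddCommGroup EN] [Module 𝕜 EN] [TopologicalSpace EN] [IsTopologicalAddGroup EN]
  [ContinuousSMul 𝕜 EN] [PolynormableSpace 𝕜 EN]
  {N : Type*} [Group N] [TopologicalSpace N] [ChartedSpace EN N] [LocConvLieGroup 𝕜 EN N]

variable {𝕜 EG EN}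

theorem isC2ss_iff {ω : G × G → N} : IsC2ss 𝕜 EG EN ω ↔ (∀ g, ω (g, 1) = 1) ∧ 
    (∀ g, ω (1, g) = 1) ∧ SmoothNear 𝕜 (EG × EG) EN ω 1 ∧
    ∀ g : G, SmoothNear 𝕜 EG EN (fun x => ω (g, x) * (ω (g * x * g⁻¹, g))⁻¹) 1 := by
  simp only [IsC2ss, IsC2, locallySmoothAt_iff, and_assoc]

/-- The product of a cochain in `C²_ss(G, N)` with one in `C²_ss(G, Z(N))` is in `C²_ss(G, N)`. -/
theorem IsC2ss.mul_central {ω β : G × G → N} (hω : IsC2ss 𝕜 EG EN ω) (hβ : IsC2ss 𝕜 EG EN β)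
    (hc : ∀ p, β p ∈ Subgroup.center N) : IsC2ss 𝕜 EG EN (fun p => ω p * β p) := by
  rw [isC2ss_iff] at *
  obtain ⟨h1, h2, h3, h4⟩ := hω
  obtain ⟨k1, k2, k3, k4⟩ := hβ
  refine ⟨fun g => by simp [h1, k1], fun g => by simp [h2, k2], h3.mul k3, fun g => ?_⟩
  have : (fun x => ω (g, x) * β (g, x) * (ω (g * x * g⁻¹, g) * β (g * x * g⁻¹, g))⁻¹) =
      fun x => (ω (g, x) * (ω (g * x * g⁻¹, g))⁻¹) * (β (g, x) * (β (g * x * g⁻¹, g))⁻¹) := by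
    funext x
    have e := Subgroup.mem_center_iff.1 (mul_mem (hc (g, x)) (inv_mem (hc (g * x * g⁻¹, g))))
      (ω (g * x * g⁻¹, g))⁻¹
    rw [mul_inv_rev, mul_assoc, ← mul_assoc (β _), ← e, ← mul_assoc]
  rw [this]
  exact (h4 g).mul (k4 g)

theorem IsC2ss.inv_central {β : G × G → N} (hβ : IsC2ss 𝕜 EG EN β)
    (hc : ∀ p, β p ∈ Subgroup.center N) : IsC2ss 𝕜 EG EN (fun p => (β p)⁻¹) := by
  rw [isC2ss_iff] at *
  obtain ⟨k1, k2, k3, k4⟩ := hβ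
  refine ⟨fun g => by simp [k1], fun g => by simp [k2], k3.inv, fun g => ?_⟩
  have : (fun x => (β (g, x))⁻¹ * ((β (g * x * g⁻¹, g))⁻¹)⁻¹) =
      fun x => (β (g, x) * (β (g * x * g⁻¹, g))⁻¹)⁻¹ := by
    funext x
    rw [mul_inv_rev, Subgroup.mem_center_iff.1 (inv_mem (hc (g, x)))]
  rw [this]
  exact (k4 g).inv

variable (𝕜 EG EN)

/-- `Z²_ss(G, Z(N))_S`. -/
def Z2ss (S : G → MulAut N) : Subgroup (G × G → Subgroup.center N) where
  carrier := {β | IsC2ss 𝕜 EG EN (fun p => (β p : N)) ∧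
    ∀ g g' g'', d2 S (fun p => (β p : N)) g g' g'' = 1}
  one_mem' := by
    refine ⟨isC2ss_iff.2 ⟨by simp, by simp, by simpa using SmoothNear.const _ _,
      by simpa using SmoothNear.const _ _⟩, by simp [d2]⟩
  mul_mem' := by
    rintro a b ⟨ha, ha'⟩ ⟨hb, hb'⟩
    refine ⟨by simpa using ha.mul_central hb fun p => (b p).2, fun g g' g'' => ?_⟩
    have e1 : centerMap (S g) (a (g', g'')) * a (g, g' * g'') * (a (g * g', g''))⁻¹ * (a (g, g'))⁻¹
      = 1 := Subtype.ext (ha' g g' g'')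
    have e2 : centerMap (S g) (b (g', g'')) * b (g, g' * g'') * (b (g * g', g''))⁻¹ * (b (g, g'))⁻¹
      = 1 := Subtype.ext (hb' g g' g'')
    have e3 : centerMap (S g) ((a * b) (g', g'')) * (a * b) (g, g' * g'') *
        ((a * b) (g * g', g''))⁻¹ * ((a * b) (g, g'))⁻¹ = 1 := by
      rw [← mul_one (1 : Subgroup.center N)]
      nth_rewrite 1 [← e1]
      rw [← e2]
      simp only [Pi.mul_apply, map_mul, mul_inv]
      simp only [mul_comm, mul_left_comm, mul_assoc]
    exact congrArg Subtype.val e3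
  inv_mem' := by
    rintro a ⟨ha, ha'⟩
    refine ⟨by simpa using ha.inv_central fun p => (a p).2, fun g g' g'' => ?_⟩
    have e1 : centerMap (S g) (a (g', g'')) * a (g, g' * g'') * (a (g * g', g''))⁻¹ * (a (g, g'))⁻¹
      = 1 := Subtype.ext (ha' g g' g'')
    have e3 : centerMap (S g) (a⁻¹ (g', g'')) * a⁻¹ (g, g' * g'') *
        (a⁻¹ (g * g', g''))⁻¹ * (a⁻¹ (g, g'))⁻¹ = 1 := by
      rw [← inv_one, ← e1]
      simp only [Pi.inv_apply, map_inv, mul_inv]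
    exact congrArg Subtype.val e3

/-- `B²_s(G, Z(N))_S`. -/
def B2s (S : G → MulAut N) : Subgroup (G × G → Subgroup.center N) where
  carrier := {β | ∃ α : G → Subgroup.center N, IsC1 𝕜 EG EN (fun g => (α g : N)) ∧
    ∀ g g', (β (g, g') : N) = d1 S (fun g => (α g : N)) g g'}
  one_mem' := ⟨1, ⟨by simp, locallySmoothAt_iff.2 (by simpa using SmoothNear.const _ _)⟩,
    by simp [d1]⟩
  mul_mem' := by
    rintro a b ⟨α, ⟨h1, h2⟩, h3⟩ ⟨β, ⟨k1, k2⟩, k3⟩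
    rw [locallySmoothAt_iff] at h2 k2
    refine ⟨α * β, ⟨by simp [h1, k1], locallySmoothAt_iff.2 (by simpa using h2.mul k2)⟩, ?_⟩
    intro g g'
    have e1 : a (g, g') = centerMap (S g) (α g') * (α (g * g'))⁻¹ * α g := Subtype.ext (h3 g g')
    have e2 : b (g, g') = centerMap (S g) (β g') * (β (g * g'))⁻¹ * β g := Subtype.ext (k3 g g')
    have e3 : (a * b) (g, g') =
        centerMap (S g) ((α * β) g') * ((α * β) (g * g'))⁻¹ * (α * β) g := by
      simp only [Pi.mul_apply, map_mul, mul_inv, e1, e2]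
      simp only [mul_comm, mul_left_comm, mul_assoc]
    exact congrArg Subtype.val e3
  inv_mem' := by
    rintro a ⟨α, ⟨h1, h2⟩, h3⟩
    rw [locallySmoothAt_iff] at h2
    refine ⟨α⁻¹, ⟨by simp [h1], locallySmoothAt_iff.2 (by simpa using h2.inv)⟩, fun g g' => ?_⟩
    have e1 : a (g, g') = centerMap (S g) (α g') * (α (g * g'))⁻¹ * α g := Subtype.ext (h3 g g')
    have e3 : a⁻¹ (g, g') = centerMap (S g) (α⁻¹ g') * (α⁻¹ (g * g'))⁻¹ * α⁻¹ g := by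
      simp only [Pi.inv_apply, map_inv, e1, mul_inv]
    exact congrArg Subtype.val e3

/-- `H²_ss(G, Z(N))_S = Z²_ss(G, Z(N))_S / B²_s(G, Z(N))_S`. -/
abbrev H2ss (S : G → MulAut N) : Type _ :=
  Z2ss 𝕜 EG EN S ⧸ (B2s 𝕜 EG EN S).subgroupOf (Z2ss 𝕜 EG EN S)

end Cohomology

section Extensions

set_option linter.unusedSectionVars false

section IsLieExtension

variable (𝕜 : Type*) [RCLike 𝕜]
  (EG : Type*) [AddCommGroup EG] [Module 𝕜 EG] [TopologicalSpace EG]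
  {G : Type*} [Group G] [TopologicalSpace G] [ChartedSpace EG G]
  (EN : Type*) [AddCommGroup EN] [Module 𝕜 EN] [TopologicalSpace EN]
  {N : Type*} [Group N] [TopologicalSpace N] [ChartedSpace EN N]
  (EX : Type*) [AddCommGroup EX] [Module 𝕜 EX] [TopologicalSpace EX]
  {X : Type*} [Group X] [TopologicalSpace X] [ChartedSpace EX X]

/-- `1 → N → X → G → 1` is an extension of Lie groups: a short exact sequence of Lie group
morphisms for which `X` is a smooth principal `N`-bundle over `G`. The last field is the local
triviality of this bundle: over some open `U ∋ g` there is a smooth section `σ` such that the smooth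
bijection `U × N → q⁻¹(U)`, `(y, n) ↦ σ(y) ι(n)`, has a smooth inverse `x ↦ (q x, τ x)`. -/
structure IsLieExtension (ι : N →* X) (q : X →* G) : Prop where
  smooth_ι : SmoothMap 𝕜 EN EX ι
  smooth_q : SmoothMap 𝕜 EX EG q
  injective : Function.Injective ι
  exact : ι.range = q.ker
  surjective : Function.Surjective q
  principal : ∀ g : G, ∃ U : Set G, IsOpen U ∧ g ∈ U ∧
    ∃ σ : G → X, SmoothOnSet 𝕜 EG EX σ U ∧ (∀ y ∈ U, q (σ y) = y) ∧
      ∃ τ : X → N, SmoothOnSet 𝕜 EX EN τ (q ⁻¹' U) ∧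
        ∀ x ∈ q ⁻¹' U, x = σ (q x) * ι (τ x)

end IsLieExtension

variable (𝕜 : Type w) [RCLike 𝕜]
  (EG : Type u) [AddCommGroup EG] [Module 𝕜 EG] [TopologicalSpace EG]
  (G : Type u) [Group G] [TopologicalSpace G] [ChartedSpace EG G]
  (EN : Type v) [AddCommGroup EN] [Module 𝕜 EN] [TopologicalSpace EN]
  (N : Type v) [Group N] [TopologicalSpace N] [ChartedSpace EN N]

/-- A Lie group extension of `G` by `N`; the total group may be modelled on any locally convex
space. -/
structure LieExtension where
  carrier : Type (max u v)
  model : Type (max u v)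
  [addCommGroup : AddCommGroup model]
  [module : Module 𝕜 model]
  [topologicalSpaceModel : TopologicalSpace model]
  [isTopologicalAddGroup : IsTopologicalAddGroup model]
  [continuousSMul : ContinuousSMul 𝕜 model]
  [polynormableSpace : PolynormableSpace 𝕜 model]
  [t2Space : T2Space model]
  [group : Group carrier]
  [topologicalSpace : TopologicalSpace carrier]
  [chartedSpace : ChartedSpace model carrier]
  [lieGroup : LocConvLieGroup 𝕜 model carrier]
  ι : N →* carrier
  q : carrier →* G
  isLieExtension : IsLieExtension 𝕜 EG EN model ι q

attribute [instance] LieExtension.addCommGroup LieExtension.module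
  LieExtension.topologicalSpaceModel LieExtension.isTopologicalAddGroup LieExtension.continuousSMul
  LieExtension.polynormableSpace LieExtension.t2Space LieExtension.group
  LieExtension.topologicalSpace LieExtension.chartedSpace LieExtension.lieGroup

variable {𝕜 EG G EN N}

/-- Equivalence of extensions: there is a morphism of Lie groups which is the identity on `N` and
on `G`. -/
def LieExtension.Equivalent (X Y : LieExtension 𝕜 EG G EN N) : Prop :=
  ∃ φ : X.carrier →* Y.carrier, SmoothMap 𝕜 X.model Y.model φ ∧
    (∀ n, φ (X.ι n) = Y.ι n) ∧ ∀ x, Y.q (φ x) = X.q x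

section Equivalence

variable [IsTopologicalAddGroup EG] [ContinuousSMul 𝕜 EG] [PolynormableSpace 𝕜 EG]
  [LocConvLieGroup 𝕜 EG G] [IsTopologicalAddGroup EN] [ContinuousSMul 𝕜 EN]
  [PolynormableSpace 𝕜 EN] [LocConvLieGroup 𝕜 EN N]

theorem LieExtension.Equivalent.symm {X Y : LieExtension 𝕜 EG G EN N} (h : X.Equivalent Y) :
    Y.Equivalent X := by
  obtain ⟨φ, hφ, hι, hq⟩ := h
  have hX := X.isLieExtension
  have hY := Y.isLieExtension
  have kerX : ∀ x, X.q x = 1 → ∃ n, X.ι n = x := fun x hx => by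
    have : x ∈ X.ι.range := by rw [hX.exact]; exact hx
    exact this
  have kerY : ∀ x, Y.q x = 1 → ∃ n, Y.ι n = x := fun x hx => by
    have : x ∈ Y.ι.range := by rw [hY.exact]; exact hx
    exact this
  have hinj : Function.Injective φ := by
    rw [injective_iff_map_eq_one]
    intro x hx
    obtain ⟨n, rfl⟩ := kerX x (by rw [← hq, hx, map_one])
    rw [hι] at hx
    rw [hY.injective (hx.trans (map_one _).symm), map_one]
  have hsurj : Function.Surjective φ := by
    intro y
    obtain ⟨x, hx⟩ := hX.surjective (Y.q y)
    obtain ⟨n, hn⟩ := kerY ((φ x)⁻¹ * y) (by rw [map_mul, map_inv, hq, hx, inv_mul_cancel])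
    exact ⟨x * X.ι n, by rw [map_mul, hι, hn, mul_inv_cancel_left]⟩
  let Φ := MulEquiv.ofBijective φ ⟨hinj, hsurj⟩
  have hΦ : ∀ y, φ (Φ.symm y) = y := fun y => Φ.apply_symm_apply y
  refine ⟨Φ.symm.toMonoidHom, fun y => ?_, fun n => ?_, fun y => ?_⟩
  · obtain ⟨U, hU, hyU, σ, hσ, hσq, -⟩ := hX.principal (Y.q y)
    obtain ⟨V, hV, h1V, ρ, -, -, τ, hτ, hτρ⟩ := hY.principal 1
    have hYqc : Continuous Y.q := continuous_iff_continuousAt.2 fun z => (hY.smooth_q z).continuousAt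
    let z : Y.carrier → Y.carrier := fun y' => (φ (σ (Y.q y')))⁻¹ * y'
    have hz1 : ∀ y', Y.q y' ∈ U → Y.q (z y') = 1 := fun y' hy' => by
      simp only [z, map_mul, map_inv, hq, hσq _ hy', inv_mul_cancel]
    have hσs : SmoothNear 𝕜 Y.model X.model (fun y' => σ (Y.q y')) y :=
      SmoothNear.comp (F := EG) (g := σ) (hσ _ hyU) (hY.smooth_q y)
    have hzs : SmoothNear 𝕜 Y.model Y.model z y :=
      (SmoothNear.comp (F := X.model) (g := φ) (hφ _) hσs).inv.mul (SmoothNear.id y)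
    have hτs : SmoothNear 𝕜 Y.model EN (fun y' => τ (z y')) y :=
      SmoothNear.comp (F := Y.model) (g := τ)
        (hτ _ (by simpa [hz1 y hyU] using h1V)) hzs
    have hns : SmoothNear 𝕜 Y.model EN (fun y' => (τ 1)⁻¹ * τ (z y')) y :=
      (SmoothNear.const _ _).mul hτs
    have hψ : SmoothNear 𝕜 Y.model X.model
        (fun y' => σ (Y.q y') * X.ι ((τ 1)⁻¹ * τ (z y'))) y :=
      hσs.mul (SmoothNear.comp (F := EN) (g := X.ι) (hX.smooth_ι _) hns)
    refine hψ.congr ?_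
    filter_upwards [hYqc.continuousAt.preimage_mem_nhds (hU.mem_nhds hyU)] with y' hy'
    apply hinj
    have e1 := hτρ 1 (by simpa using h1V)
    have e2 := hτρ (z y') (by simpa [hz1 y' hy'] using h1V)
    rw [hz1 y' hy'] at e2
    rw [map_one] at e1
    have e3 : Y.ι ((τ 1)⁻¹ * τ (z y')) = z y' := by
      rw [map_mul, map_inv]
      nth_rewrite 2 [e2]
      rw [eq_comm, mul_eq_one_iff_eq_inv] at e1
      rw [e1]
    change φ _ = φ (Φ.symm y')
    rw [hΦ, map_mul, hι, e3]
    simp [z]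
  · apply hinj
    change φ (Φ.symm _) = _
    rw [hΦ, hι]
  · change X.q (Φ.symm y) = _
    rw [← hq, hΦ]

variable (𝕜 EG G EN N)

instance LieExtension.setoid : Setoid (LieExtension 𝕜 EG G EN N) where
  r := LieExtension.Equivalent
  iseqv :=
    { refl := fun X => ⟨MonoidHom.id _, fun x => SmoothNear.id x, fun _ => rfl, fun _ => rfl⟩
      symm := fun h => h.symm
      trans := by
        rintro X Y Z ⟨φ, hφ, h1, h2⟩ ⟨ψ, hψ, h3, h4⟩
        exact ⟨ψ.comp φ, fun x => SmoothNear.comp (F := Y.model) (g := ψ) (hψ _) (hφ x),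
          fun n => by simp [h1, h3], fun x => by simp [h2, h4]⟩ }

/-- `Ext(G, N)`: the equivalence classes of Lie group extensions of `G` by `N`. -/
abbrev ExtClasses : Type _ := Quotient (LieExtension.setoid 𝕜 EG G EN N)

variable {G N}

/-- The extension `X` corresponds to the `G`-kernel `[S]`: for a normalized locally smooth section
`σ` of `q`, the outer action `S' = C_N ∘ σ` is equivalent to `S`. -/
def LieExtension.Corresponds (X : LieExtension 𝕜 EG G EN N) (S : G → MulAut N) : Prop :=
  ∃ σ : G → X.carrier, IsC1 𝕜 EG X.model σ ∧ (∀ g, X.q (σ g) = g) ∧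
    ∃ S' : G → MulAut N, (∀ g n, X.ι (S' g n) = σ g * X.ι n * (σ g)⁻¹) ∧ OuterEquiv 𝕜 EG EN S S'

/-- `Ext(G, N)_[S]`. -/
def ExtKernel (S : G → MulAut N) : Set (ExtClasses 𝕜 EG G EN N) :=
  {e | ∃ X : LieExtension 𝕜 EG G EN N, ⟦X⟧ = e ∧ X.Corresponds 𝕜 EG EN S}

variable (G N)

/-- Smooth factor systems for `(G, N)`: the elements `(S, ω)` of `Z²_ss(G, N)`. -/
structure FactorSystem where
  S : G → MulAut N
  ω : G × G → N
  isC1Aut : IsC1Aut 𝕜 EG EN S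
  isC2ss : IsC2ss 𝕜 EG EN ω
  delta_eq : ∀ g g', deltaAut S g g' = MulAut.conj (ω (g, g'))
  d2_eq : ∀ g g' g'', d2 S ω g g' g'' = 1

variable {𝕜 EG EN G N}

/-- The underlying set `N × G` of `N ×_(S,ω) G`; a separate type, since it carries neither the
product group structure nor the product topology. -/
@[ext]
structure TwistedProduct (f : FactorSystem 𝕜 EG G EN N) where
  fst : N
  snd : G

namespace FactorSystem

variable (f : FactorSystem 𝕜 EG G EN N)

theorem mul_apply (g g' : G) (n : N) :
    f.S g (f.S g' n) = f.ω (g, g') * f.S (g * g') n * (f.ω (g, g'))⁻¹ := by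
  have h := f.delta_eq g g'
  rw [deltaAut, mul_inv_eq_iff_eq_mul] at h
  have := DFunLike.congr_fun h n
  simpa [MulAut.mul_apply, MulAut.conj_apply] using this

theorem cocycle (g g' g'' : G) :
    f.S g (f.ω (g', g'')) * f.ω (g, g' * g'') = f.ω (g, g') * f.ω (g * g', g'') := by
  have h := f.d2_eq g g' g''
  rwa [d2, mul_inv_eq_one, mul_inv_eq_iff_eq_mul] at h

end FactorSystem

/-- The multiplication `(n, g)(n', g') = (n S(g)(n') ω(g, g'), gg')`. -/
instance TwistedProduct.group (f : FactorSystem 𝕜 EG G EN N) : Group (TwistedProduct f) :=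
  letI : Mul (TwistedProduct f) := ⟨fun x y => ⟨x.fst * f.S x.snd y.fst * f.ω (x.snd, y.snd),
    x.snd * y.snd⟩⟩
  letI : One (TwistedProduct f) := ⟨⟨1, 1⟩⟩
  letI : Inv (TwistedProduct f) := ⟨fun x => ⟨(f.ω (x.snd⁻¹, x.snd))⁻¹ * f.S x.snd⁻¹ x.fst⁻¹,
    x.snd⁻¹⟩⟩
  Group.ofLeftAxioms
    (by
      intro x y z
      refine TwistedProduct.ext ?_ (mul_assoc _ _ _)
      change x.fst * f.S x.snd y.fst * f.ω (x.snd, y.snd) * f.S (x.snd * y.snd) z.fst *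
        f.ω (x.snd * y.snd, z.snd) = x.fst * f.S x.snd (y.fst * f.S y.snd z.fst *
          f.ω (y.snd, z.snd)) * f.ω (x.snd, y.snd * z.snd)
      simp only [map_mul, f.mul_apply]
      have := f.cocycle x.snd y.snd z.snd
      simp only [mul_assoc, this]
      simp)
    (by
      intro x
      refine TwistedProduct.ext ?_ (one_mul _)
      change 1 * f.S 1 x.fst * f.ω (1, x.snd) = x.fst
      simp [f.isC1Aut.map_one, f.isC2ss.1.2.1])
    (by
      intro x
      refine TwistedProduct.ext ?_ (inv_mul_cancel _)
      change (f.ω (x.snd⁻¹, x.snd))⁻¹ * f.S x.snd⁻¹ x.fst⁻¹ * f.S x.snd⁻¹ x.fst *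
        f.ω (x.snd⁻¹, x.snd) = 1
      simp)

/-- The inclusion `N → N ×_(S,ω) G`, `n ↦ (n, 1)`. -/
def TwistedProduct.inl (f : FactorSystem 𝕜 EG G EN N) : N →* TwistedProduct f where
  toFun n := ⟨n, 1⟩
  map_one' := rfl
  map_mul' n n' := by
    refine TwistedProduct.ext ?_ (one_mul _).symm
    change n * n' = n * f.S 1 n' * f.ω (1, 1)
    simp [f.isC1Aut.map_one, f.isC2ss.1.2.1]

/-- The projection `N ×_(S,ω) G → G`. -/
def TwistedProduct.proj (f : FactorSystem 𝕜 EG G EN N) : TwistedProduct f →* G where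
  toFun x := x.snd
  map_one' := rfl
  map_mul' _ _ := rfl

/-- A Lie group structure on the group `N ×_(S,ω) G` for which `N × G → N ×_(S,ω) G`,
`(n, g) ↦ (n, g)`, is smooth on `N × U` for an open identity neighbourhood `U ⊆ G`, and for which
`N → N ×_(S,ω) G → G` is an extension of Lie groups. -/
structure TwistedLieStructure (f : FactorSystem 𝕜 EG G EN N) where
  model : Type (max u v)
  [addCommGroup : AddCommGroup model]
  [module : Module 𝕜 model]
  [topologicalSpaceModel : TopologicalSpace model]
  [isTopologicalAddGroup : IsTopologicalAddGroup model]
  [continuousSMul : ContinuousSMul 𝕜 model]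
  [polynormableSpace : PolynormableSpace 𝕜 model]
  [t2Space : T2Space model]
  [topologicalSpace : TopologicalSpace (TwistedProduct f)]
  [chartedSpace : ChartedSpace model (TwistedProduct f)]
  [lieGroup : LocConvLieGroup 𝕜 model (TwistedProduct f)]
  isLieExtension : IsLieExtension 𝕜 EG EN model (TwistedProduct.inl f) (TwistedProduct.proj f)
  smooth_mk : ∃ U : Set G, IsOpen U ∧ 1 ∈ U ∧
    SmoothOnSet 𝕜 (EN × EG) model (fun p : N × G => (⟨p.1, p.2⟩ : TwistedProduct f)) (univ ×ˢ U)

attribute [instance] TwistedLieStructure.addCommGroup TwistedLieStructure.module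
  TwistedLieStructure.topologicalSpaceModel TwistedLieStructure.isTopologicalAddGroup
  TwistedLieStructure.continuousSMul TwistedLieStructure.polynormableSpace
  TwistedLieStructure.t2Space

/-- The extension `N ×_(S,ω) G`, with a given Lie group structure as above. -/
def TwistedLieStructure.toLieExtension {f : FactorSystem 𝕜 EG G EN N}
    (L : TwistedLieStructure f) : LieExtension 𝕜 EG G EN N :=
  letI := L.topologicalSpace
  letI := L.chartedSpace
  letI := L.lieGroup
  { carrier := TwistedProduct f
    model := L.model
    ι := TwistedProduct.inl f
    q := TwistedProduct.proj f
    isLieExtension := L.isLieExtension }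

/-- `e` is the equivalence class `[N ×_(S,ω) G]`. -/
def IsTwistedClass (f : FactorSystem 𝕜 EG G EN N) (e : ExtClasses 𝕜 EG G EN N) : Prop :=
  ∃ L : TwistedLieStructure f, ⟦L.toLieExtension⟧ = e

/-- Equivalent outer actions agree on the centre. -/
theorem OuterEquiv.eq_on_center {S S' : G → MulAut N} (h : OuterEquiv 𝕜 EG EN S S') (g : G) {z : N}
    (hz : z ∈ Subgroup.center N) : S' g z = S g z := by
  obtain ⟨h, -, hh⟩ := h
  have := Subgroup.mem_center_iff.1 (map_center (S g) hz) (h g)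
  rw [hh, MulAut.mul_apply, MulAut.conj_apply, this, mul_inv_cancel_right]

theorem central_rearrange (p q r s a b c d : N) (ha : ∀ n, n * a = a * n)
    (hb : ∀ n, n * b = b * n) (hc : ∀ n, n * c⁻¹ = c⁻¹ * n) (hd : ∀ n, n * d⁻¹ = d⁻¹ * n) :
    p * a * (q * b) * (r * c)⁻¹ * (s * d)⁻¹ = p * q * r⁻¹ * s⁻¹ * (a * b * c⁻¹ * d⁻¹) := by
  have e1 : p * a * (q * b) = p * q * (a * b) := by
    rw [mul_assoc, ← mul_assoc a, ← ha q]; simp only [mul_assoc]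
  have e2 : ∀ n : N, (a * b * c⁻¹) * n = n * (a * b * c⁻¹) := fun n => by
    rw [mul_assoc, ← hc, ← mul_assoc, mul_assoc a, ← hb, ← mul_assoc, ← ha]
    simp only [mul_assoc]
  rw [e1, mul_inv_rev, mul_inv_rev, ← hd]
  calc p * q * (a * b) * (c⁻¹ * r⁻¹) * (s⁻¹ * d⁻¹)
      = p * q * ((a * b * c⁻¹) * (r⁻¹ * s⁻¹)) * d⁻¹ := by simp only [mul_assoc]
    _ = p * q * r⁻¹ * s⁻¹ * (a * b * c⁻¹ * d⁻¹) := by rw [e2]; simp only [mul_assoc]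

/-- For a smooth factor system `(S', ω)` with `S' ∼ S` and `β ∈ Z²_ss(G, Z(N))_[S]`, the smooth
factor system `(S', ω · β)`. -/
def FactorSystem.twist {S : G → MulAut N} (f : FactorSystem 𝕜 EG G EN N)
    (hf : OuterEquiv 𝕜 EG EN S f.S) (β : Z2ss 𝕜 EG EN S) : FactorSystem 𝕜 EG G EN N where
  S := f.S
  ω := fun p => f.ω p * (β.1 p : N)
  isC1Aut := f.isC1Aut
  isC2ss := f.isC2ss.mul_central β.2.1 fun p => (β.1 p).2
  delta_eq g g' := by
    have : MulAut.conj (β.1 (g, g') : N) = 1 := by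
      ext n
      rw [MulAut.conj_apply, ← Subgroup.mem_center_iff.1 (β.1 (g, g')).2 n]
      simp
    rw [f.delta_eq, map_mul, this, mul_one]
  d2_eq g g' g'' := by
    have h1 := β.2.2 g g' g''
    have h2 := f.d2_eq g g' g''
    unfold d2 at *
    simp only [map_mul, hf.eq_on_center g (β.1 (g', g'')).2]
    have c1 := Subgroup.mem_center_iff.1 (map_center (S g) (β.1 (g', g'')).2)
    have c2 := Subgroup.mem_center_iff.1 (β.1 (g, g' * g'')).2
    have c3 := Subgroup.mem_center_iff.1 (inv_mem (β.1 (g * g', g'')).2)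
    have c4 := Subgroup.mem_center_iff.1 (inv_mem (β.1 (g, g')).2)
    set a := S g (β.1 (g', g'') : N)
    set b : N := (β.1 (g, g' * g'') : N)
    set c : N := (β.1 (g * g', g'') : N)
    set d : N := (β.1 (g, g') : N)
    calc _ = (f.S g (f.ω (g', g'')) * f.ω (g, g' * g'') * (f.ω (g * g', g''))⁻¹ *
          (f.ω (g, g'))⁻¹) * (a * b * c⁻¹ * d⁻¹) := by
          exact central_rearrange _ _ _ _ _ _ _ _ c1 c2 c3 c4
      _ = 1 := by rw [h1, h2, mul_one]

end Equivalence

end Extensions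

end NonabelianExt

open NonabelianExt

/-! The theorem is the Schreier classification of extensions, with smoothness required only near the
identity. It rests on passing between extensions and factor systems.

From factor systems to extensions: the group `N ×_(S,ω) G` is covered by right translates of `N ×
U`, with `U` a small symmetric identity neighbourhood. The cocycle identity makes the transition
maps smooth (`patch_transition`), although `ω` is smooth only near the identity. Right translations
are then smooth, multiplication and inversion are smooth near 1, and the defining condition of
`C²_ss` is what makes conjugations smooth near 1. These properties together give a Lie group
(`LocConvLieGroup.of_smoothNear_one`), and `FactorSystem.nonempty_twistedLieStructure` shows that it
is an extension.

From extensions to factor systems: a section `σ` inducing `S' = C_N(k) S` can be corrected to `ρ =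
ι(k)⁻¹ σ`, which induces `S` itself. Then `ω(g, g') = ρ(g) ρ(g') ρ(gg')⁻¹` is a smooth factor system
and `(n, g) ↦ ι(n) ρ(g)` is an equivalence (`LieExtension.exists_factorSystem`). Thus every class of
the kernel is represented over the fixed `S`.

Comparison: an equivalence is the identity on `N` and on `G`, so it has the form `(n, g) ↦ (n h(g),
g)` for some `h ∈ C¹_s`, and conversely (`TwistedLieStructure.equivalent_iff`). The case `h = 1`
shows that the class does not depend on the chosen Lie structure. If both sides have the same `S`,
then `h` is central, and its equation says that the central cocycles differ by the coboundary of
`h⁻¹` (`FactorSystem.exists_intertwines_twist_iff`). Two factor systems over the same `S` differ by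
a central cocycle (`FactorSystem.exists_difference`), which gives transitivity. Well-definedness and
freeness both follow from `IsTwistedClass.twist_eq_iff`. -/

namespace NonabelianExt

/-! ### Locality of differentiability classes -/

section Locality

variable {𝕜 : Type*} [RCLike 𝕜]

theorem HasDirDeriv.unique {X Y : Type*} [AddCommGroup X] [Module 𝕜 X]
    [AddCommGroup Y] [Module 𝕜 Y] [TopologicalSpace Y] [T2Space Y] {f : X → Y} {x h : X} {y z : Y}
    (hy : HasDirDeriv 𝕜 f x h y) (hz : HasDirDeriv 𝕜 f x h z) : y = z :=
  tendsto_nhds_unique hy hz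

/-- For maps into Hausdorff spaces, being of class `C^n` is a local property. -/
theorem CnOn.of_locally {n : ℕ} : ∀ {X : Type*} {Y : Type*} [AddCommGroup X] [Module 𝕜 X]
    [TopologicalSpace X] [IsTopologicalAddGroup X] [ContinuousSMul 𝕜 X]
    [AddCommGroup Y] [Module 𝕜 Y] [TopologicalSpace Y] [T2Space Y] {f : X → Y} {U : Set X},
    IsOpen U → (∀ x ∈ U, ∃ O, IsOpen O ∧ x ∈ O ∧ CnOn 𝕜 n f O) → CnOn 𝕜 n f U := by
  induction n with
  | zero =>
    intro X Y _ _ _ _ _ _ _ _ _ f U _ h x hx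
    obtain ⟨O, hO, hxO, hf⟩ := h x hx
    exact (ContinuousOn.continuousAt hf (hO.mem_nhds hxO)).continuousWithinAt
  | succ n ih =>
    intro X Y _ _ _ _ _ _ _ _ _ f U hU h
    have hc : ContinuousOn f U := fun x hx => by
      obtain ⟨O, hO, hxO, hf⟩ := h x hx
      exact (hf.continuousOn.continuousAt (hO.mem_nhds hxO)).continuousWithinAt
    -- Each point `x` gets its own derivative `D x`, valid on `O x`. The global one is read on the
    -- diagonal, `p ↦ D p.1 p`; near a given point it agrees with a single `D x`, because
    -- directional derivatives in a Hausdorff space are unique.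
    choose! O hO hxO hfc D hD hDn using h
    refine ⟨hc, fun p => D p.1 p, fun x hx v => hD x hx x (hxO x hx) v,
      ih (hU.prod isOpen_univ) fun p hp => ?_⟩
    have hV : IsOpen ((O p.1 ∩ U) ×ˢ (univ : Set X)) :=
      ((hO _ hp.1).inter hU).prod isOpen_univ
    refine ⟨_, hV, ⟨⟨hxO _ hp.1, hp.1⟩, trivial⟩, ((hDn _ hp.1).mono
      (prod_mono inter_subset_left subset_rfl)).congr hV fun y hy => ?_⟩
    exact (hD y.1 hy.1.2 y.1 (hxO _ hy.1.2) y.2).unique (hD p.1 hp.1 y.1 hy.1.1 y.2)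

end Locality

/-! ### Gluing a manifold from patches -/

section Gluing

variable {𝕜 : Type*} [RCLike 𝕜]
  {E F : Type*} [AddCommGroup E] [Module 𝕜 E] [TopologicalSpace E]
  [AddCommGroup F] [Module 𝕜 F] [TopologicalSpace F]
  {M M' : Type*} [TopologicalSpace M] [ChartedSpace E M] [TopologicalSpace M'] [ChartedSpace F M']

/-- Smoothness near a point can be tested in any pair of charts. -/
theorem SmoothNear.exists_charts [IsTopologicalAddGroup E] [ContinuousSMul 𝕜 E]
    [IsTopologicalAddGroup F] [ContinuousSMul 𝕜 F] [PolynormableSpace 𝕜 F]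
    [SmoothManifold 𝕜 E M] [SmoothManifold 𝕜 F M'] {f : M → M'} {x : M}
    (hf : SmoothNear 𝕜 E F f x) {e : OpenPartialHomeomorph M E} (he : e ∈ atlas E M)
    (hx : x ∈ e.source) {e' : OpenPartialHomeomorph M' F} (he' : e' ∈ atlas F M')
    (hx' : f x ∈ e'.source) :
    ∃ O : Set E, IsOpen O ∧ O ⊆ e.target ∧ e x ∈ O ∧ MapsTo (f ∘ e.symm) O e'.source ∧
      SmoothOnOpen 𝕜 (e' ∘ f ∘ e.symm) O := by
  obtain ⟨d, hd, O, hO, hOt, hxO, hm, hs⟩ := hf.exists_chart he hx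
  have htr := SmoothManifold.compatible (𝕜 := 𝕜) d hd e' he'
  have hTo : IsOpen (d.target ∩ d.symm ⁻¹' e'.source) :=
    d.isOpen_inter_preimage_symm e'.open_source
  have key : ∀ u ∈ O, d.symm (d (f (e.symm u))) = f (e.symm u) := fun u hu => d.left_inv (hm hu)
  have hO1 := ((hs 0).continuousOn).isOpen_inter_preimage hO hTo
  refine ⟨_, hO1, inter_subset_left.trans hOt, ⟨hxO, ?_, ?_⟩, fun u hu => ?_, fun n => ?_⟩
  · exact d.map_source (hm hxO)
  · have h := key _ hxO
    rw [e.left_inv hx] at h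
    simpa [h, hx] using hx'
  · have := hu.2.2
    simpa [key u hu.1] using this
  · refine ((htr n).comp hTo ((hs n).mono inter_subset_left) fun u hu => hu.2).congr hO1
      fun u hu => ?_
    simp [key u hu.1]

/-- A set covered by patches of a manifold with smooth transition maps is a manifold. -/
theorem exists_smoothManifold_of_patches [IsTopologicalAddGroup E] [ContinuousSMul 𝕜 E]
    [PolynormableSpace 𝕜 E] [T2Space E] [SmoothManifold 𝕜 E M] {T I : Type*}
    (P : I → PartialEquiv T M) (hcov : ∀ x, ∃ i, x ∈ (P i).source)
    (hopen : ∀ i j, IsOpen ((P i).symm.trans (P j)).source)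
    (htr : ∀ i j, SmoothOnSet 𝕜 E E ((P i).symm.trans (P j)) ((P i).symm.trans (P j)).source) :
    ∃ (_ : TopologicalSpace T) (_ : ChartedSpace E T), SmoothManifold 𝕜 E T ∧
      ∀ i, IsOpen (P i).source ∧ SmoothOnSet 𝕜 E E (P i) (P i).source ∧
        SmoothOnSet 𝕜 E E (P i).symm (P i).target := by
  choose idx hidx using hcov
  have htc : ∀ i j, ContinuousOn ((P i).symm.trans (P j)) ((P i).symm.trans (P j)).source :=
    fun i j p hp => (htr i j p hp).continuousAt.continuousWithinAt
  -- The charts of `T` are the patches followed by charts of `M`.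
  let patch (i : I) (e : OpenPartialHomeomorph M E) : PartialEquiv T E :=
    (P i).trans e.toPartialEquiv
  have hsrc : ∀ i j (e e' : OpenPartialHomeomorph M E),
      ((patch i e).symm.trans (patch j e')).source = e.target ∩ e.symm ⁻¹'
        (((P i).symm.trans (P j)).source ∩ ((P i).symm.trans (P j)) ⁻¹' e'.source) := by
    intro i j e e'
    ext u
    simp only [patch, PartialEquiv.trans_source, PartialEquiv.symm_source,
      PartialEquiv.trans_symm_eq_symm_trans_symm, mem_inter_iff,
      mem_preimage, PartialEquiv.coe_trans, Function.comp_apply]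
    tauto
  have hmid : ∀ i j (e' : OpenPartialHomeomorph M E),
      IsOpen (((P i).symm.trans (P j)).source ∩ ((P i).symm.trans (P j)) ⁻¹' e'.source) :=
    fun i j e' => (htc i j).isOpen_inter_preimage (hopen i j) e'.open_source
  -- `T` has no topology yet; it is generated by these charts, so only conditions on the transition
  -- maps have to be checked.
  let c : ChartedSpaceCore E T :=
    { atlas := {p | ∃ i, ∃ e ∈ atlas E M, p = patch i e}
      chartAt := fun x => patch (idx x) (chartAt E (P (idx x) x))
      mem_chart_source := fun x => ⟨hidx x, mem_chart_source E _⟩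
      chart_mem_atlas := fun x => ⟨idx x, _, chart_mem_atlas E _, rfl⟩
      open_source := by
        rintro _ _ ⟨i, e, he, rfl⟩ ⟨j, e', he', rfl⟩
        rw [hsrc]
        exact e.isOpen_inter_preimage_symm (hmid i j e')
      continuousOn_toFun := by
        rintro _ _ ⟨i, e, he, rfl⟩ ⟨j, e', he', rfl⟩
        rw [hsrc]
        have h1 : ContinuousOn (((P i).symm.trans (P j)) ∘ e.symm) (e.target ∩ e.symm ⁻¹'
            (((P i).symm.trans (P j)).source ∩ ((P i).symm.trans (P j)) ⁻¹' e'.source)) :=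
          (htc i j).comp (e.continuousOn_symm.mono inter_subset_left) fun u hu => hu.2.1
        exact e'.continuousOn.comp h1 fun u hu => hu.2.2 }
  let tT := c.toTopologicalSpace
  let cT := c.toChartedSpace
  -- With its converse `hmem'`, this translates between the atlas of homeomorphisms produced by the
  -- core and the set-level charts.
  have hmem : ∀ i, ∀ e ∈ atlas E M, ∃ d ∈ atlas E T, d.toPartialEquiv = patch i e := by
    intro i e he
    have h : patch i e ∈ c.atlas := ⟨i, e, he, rfl⟩
    exact ⟨c.openPartialHomeomorph _ h, mem_iUnion₂.2 ⟨_, h, rfl⟩, rfl⟩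
  have hmem' : ∀ d ∈ atlas E T, ∃ i, ∃ e ∈ atlas E M, d.toPartialEquiv = patch i e := by
    intro d hd
    obtain ⟨p, ⟨i, e, he, rfl⟩, hd⟩ := mem_iUnion₂.1 hd
    exact ⟨i, e, he, by rw [hd]; rfl⟩
  have hman : SmoothManifold 𝕜 E T := by
    refine ⟨fun d hd d' hd' => ?_⟩
    obtain ⟨i, e, he, hde⟩ := hmem' d hd
    obtain ⟨j, e', he', hde'⟩ := hmem' d' hd'
    have hset : d.target ∩ d.symm ⁻¹' d'.source = e.target ∩ e.symm ⁻¹'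
        (((P i).symm.trans (P j)).source ∩ ((P i).symm.trans (P j)) ⁻¹' e'.source) := by
      rw [← hsrc, ← hde, ← hde']; rfl
    have hfun : d' ∘ d.symm = e' ∘ ((P i).symm.trans (P j)) ∘ e.symm := by
      change d'.toPartialEquiv ∘ d.toPartialEquiv.symm = _
      rw [hde, hde']; rfl
    intro n
    rw [hfun, hset]
    -- Smoothness of a transition is known only near each point, whereas compatibility asks for one
    -- derivative on the whole overlap; this is where `E` has to be Hausdorff.
    refine CnOn.of_locally (e.isOpen_inter_preimage_symm (hmid i j e')) fun u hu => ?_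
    obtain ⟨O, hO, -, huO, -, hs⟩ := (htr i j (e.symm u) hu.2.1).exists_charts he
      (e.map_target hu.1) he' hu.2.2
    exact ⟨O, hO, by simpa [hu.1] using huO, hs n⟩
  refine ⟨tT, cT, hman, fun i => ⟨isOpen_iff_mem_nhds.2 fun x hx => ?_, fun x hx => ?_,
    fun p hp => ?_⟩⟩
  · obtain ⟨d, hd, hde⟩ := hmem i _ (chart_mem_atlas E (P i x))
    have h1 : d.source = (patch i (chartAt E (P i x))).source := congrArg PartialEquiv.source hde
    refine mem_of_superset (d.open_source.mem_nhds ?_) (?_ : d.source ⊆ _)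
    · rw [h1]; exact ⟨hx, mem_chart_source E _⟩
    · rw [h1]; exact inter_subset_left
  · obtain ⟨d, hd, hde⟩ := hmem i _ (chart_mem_atlas E (P i x))
    have h1 : d.source = (patch i (chartAt E (P i x))).source := congrArg PartialEquiv.source hde
    have h2 : d.target = (patch i (chartAt E (P i x))).target := congrArg PartialEquiv.target hde
    have h3 : ∀ u, d.symm u = (patch i (chartAt E (P i x))).symm u := fun u =>
      congrArg (fun e : PartialEquiv T E => e.symm u) hde
    have hxd : x ∈ d.source := by rw [h1]; exact ⟨hx, mem_chart_source E _⟩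
    have h4 : ∀ u ∈ d.target, P i (d.symm u) = (chartAt E (P i x)).symm u := fun u hu => by
      rw [h2] at hu
      rw [h3]
      exact (P i).right_inv hu.2
    have h5 : ∀ u ∈ d.target, u ∈ (chartAt E (P i x)).target := fun u hu => by
      rw [h2] at hu
      exact hu.1
    refine ⟨d, hd, _, chart_mem_atlas E (P i x), hxd, d.target, d.open_target, subset_rfl,
      d.map_source hxd, fun u hu => ?_, fun n => ?_⟩
    · rw [Function.comp_apply, h4 u hu]
      exact (chartAt E (P i x)).map_target (h5 u hu)
    · refine (cnOn_clm (ContinuousLinearMap.id 𝕜 E) _).congr d.open_target fun u hu => ?_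
      rw [Function.comp_apply, Function.comp_apply, h4 u hu]
      exact (chartAt E (P i x)).right_inv (h5 u hu)
  · obtain ⟨d, hd, hde⟩ := hmem i _ (chart_mem_atlas E p)
    set e := chartAt E p
    have h1 : d.source = (patch i e).source := congrArg PartialEquiv.source hde
    have h2 : d.target = (patch i e).target := congrArg PartialEquiv.target hde
    have h3 : ∀ u, d.symm u = (P i).symm (e.symm u) := fun u =>
      congrArg (fun e : PartialEquiv T E => e.symm u) hde
    have hpt : e p ∈ d.target := by
      rw [h2]
      refine ⟨mem_chart_target E p, ?_⟩
      change e.symm (e p) ∈ (P i).target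
      rwa [e.left_inv (mem_chart_source E p)]
    have h5 : d.target ⊆ e.target := by rw [h2]; exact inter_subset_left
    refine ⟨e, chart_mem_atlas E p, d, hd, mem_chart_source E p, d.target, d.open_target, h5, hpt,
      fun u hu => ?_, fun n => ?_⟩
    · rw [Function.comp_apply, ← h3]
      exact d.map_target hu
    · refine (cnOn_clm (ContinuousLinearMap.id 𝕜 E) _).congr d.open_target fun u hu => ?_
      rw [Function.comp_apply, Function.comp_apply, ← h3]
      exact d.right_inv hu

end Gluing

/-! ### Lie groups and morphisms tested at the identity -/

section LocalCriteria

variable {𝕜 : Type*} [RCLike 𝕜]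
  {E : Type*} [AddCommGroup E] [Module 𝕜 E] [TopologicalSpace E] [IsTopologicalAddGroup E]
  [ContinuousSMul 𝕜 E] [PolynormableSpace 𝕜 E]
  {F : Type*} [AddCommGroup F] [Module 𝕜 F] [TopologicalSpace F] [IsTopologicalAddGroup F]
  [ContinuousSMul 𝕜 F] [PolynormableSpace 𝕜 F]

/-- A group and manifold with smooth right translations is a Lie group if multiplication, inversion
and all conjugations are smooth near the identity. -/
theorem LocConvLieGroup.of_smoothNear_one {T : Type*} [Group T] [TopologicalSpace T]
    [ChartedSpace E T] [SmoothManifold 𝕜 E T]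
    (hr : ∀ y, SmoothMap 𝕜 E E (fun x : T => x * y))
    (hm : SmoothNear 𝕜 (E × E) E (fun p : T × T => p.1 * p.2) (1, 1))
    (hi : SmoothNear 𝕜 E E (fun x : T => x⁻¹) 1)
    (hc : ∀ y, SmoothNear 𝕜 E E (fun x : T => y * x * y⁻¹) 1) : LocConvLieGroup 𝕜 E T where
  smooth_mul := by
    -- Near `(x, y)` write `ab = (a x⁻¹) · (x (b y⁻¹) x⁻¹) · (x y)`. The first two factors are near
    -- 1, and the last is a fixed right translation.
    rintro ⟨x, y⟩
    have h1 : SmoothNear 𝕜 (E × E) E (fun p : T × T => p.1 * x⁻¹) (x, y) :=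
      SmoothNear.comp (F := E) (g := fun z : T => z * x⁻¹) (hr _ _) (SmoothNear.fst _)
    have h2 : SmoothNear 𝕜 (E × E) E (fun p : T × T => p.2 * y⁻¹) (x, y) :=
      SmoothNear.comp (F := E) (g := fun z : T => z * y⁻¹) (hr _ _) (SmoothNear.snd _)
    have h3 : SmoothNear 𝕜 (E × E) E (fun p : T × T => x * (p.2 * y⁻¹) * x⁻¹) (x, y) :=
      SmoothNear.comp (F := E) (g := fun z : T => x * z * x⁻¹)
        (by simpa using hc x) h2
    have h4 : SmoothNear 𝕜 (E × E) E
        (fun p : T × T => (p.1 * x⁻¹) * (x * (p.2 * y⁻¹) * x⁻¹)) (x, y) :=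
      SmoothNear.comp (F := E × E) (g := fun p : T × T => p.1 * p.2)
        (f := fun p : T × T => (p.1 * x⁻¹, x * (p.2 * y⁻¹) * x⁻¹)) (by simpa using hm)
        (h1.prodMk h3)
    have h5 : SmoothNear 𝕜 (E × E) E
        (fun p : T × T => (p.1 * x⁻¹) * (x * (p.2 * y⁻¹) * x⁻¹) * (x * y)) (x, y) :=
      SmoothNear.comp (F := E) (g := fun z : T => z * (x * y)) (hr _ _) h4
    simpa [mul_assoc] using h5
  smooth_inv := by
    -- Near `x`, `z⁻¹ = x⁻¹ (z x⁻¹)⁻¹ x · x⁻¹`: inversion near 1, a conjugation, then a right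
    -- translation.
    intro x
    have h1 : SmoothNear 𝕜 E E (fun z : T => (z * x⁻¹)⁻¹) x :=
      SmoothNear.comp (F := E) (g := fun z : T => z⁻¹) (by simpa using hi) (hr x⁻¹ x)
    have h2 : SmoothNear 𝕜 E E (fun z : T => x⁻¹ * (z * x⁻¹)⁻¹ * (x⁻¹)⁻¹) x :=
      SmoothNear.comp (F := E) (g := fun z : T => x⁻¹ * z * (x⁻¹)⁻¹)
        (by simpa using hc x⁻¹) h1
    have h3 : SmoothNear 𝕜 E E (fun z : T => x⁻¹ * (z * x⁻¹)⁻¹ * (x⁻¹)⁻¹ * x⁻¹) x :=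
      SmoothNear.comp (F := E) (g := fun z : T => z * x⁻¹) (hr _ _) h2
    simpa [mul_assoc] using h3

/-- A group homomorphism between Lie groups which is smooth near the identity is smooth. -/
theorem smoothMap_of_smoothNear_one {A B : Type*} [Group A] [TopologicalSpace A] [ChartedSpace E A]
    [LocConvLieGroup 𝕜 E A] [Group B] [TopologicalSpace B] [ChartedSpace F B]
    [LocConvLieGroup 𝕜 F B] (φ : A →* B) (h : SmoothNear 𝕜 E F φ 1) : SmoothMap 𝕜 E F φ := by
  intro a
  -- Left translation moves the question to the identity: `φ(x) = φ(a) φ(a⁻¹ x)`.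
  have h1 : SmoothNear 𝕜 E E (fun x : A => a⁻¹ * x) a :=
    (SmoothNear.const _ _).mul (SmoothNear.id a)
  have h2 : SmoothNear 𝕜 E F (fun x : A => φ (a⁻¹ * x)) a :=
    SmoothNear.comp (F := E) (g := φ) (by simpa using h) h1
  have h3 : SmoothNear 𝕜 E F (fun x : A => φ a * φ (a⁻¹ * x)) a := (SmoothNear.const _ _).mul h2
  simpa using h3

end LocalCriteria

section CompOfEq

variable {𝕜 : Type*} [RCLike 𝕜]
  {E F H : Type*} [AddCommGroup E] [Module 𝕜 E] [TopologicalSpace E]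
  [AddCommGroup F] [Module 𝕜 F] [TopologicalSpace F]
  [AddCommGroup H] [Module 𝕜 H] [TopologicalSpace H]
  {M M' M'' : Type*} [TopologicalSpace M] [ChartedSpace E M] [TopologicalSpace M']
  [ChartedSpace F M'] [TopologicalSpace M''] [ChartedSpace H M'']

theorem SmoothNear.comp_of_eq [IsTopologicalAddGroup E] [ContinuousSMul 𝕜 E]
    [IsTopologicalAddGroup F] [ContinuousSMul 𝕜 F]
    [IsTopologicalAddGroup H] [ContinuousSMul 𝕜 H] [PolynormableSpace 𝕜 H]
    [SmoothManifold 𝕜 F M'] {g : M' → M''} {f : M → M'} {x : M} {y : M'}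
    (hg : SmoothNear 𝕜 F H g y) (hf : SmoothNear 𝕜 E F f x) (hy : f x = y) :
    SmoothNear 𝕜 E H (fun y => g (f y)) x := by
  subst hy
  exact hg.comp hf

end CompOfEq

/-! ### The Lie group structure on `N ×_(S,ω) G` -/

section TwistedLie

set_option linter.unusedSectionVars false

variable {𝕜 : Type w} [RCLike 𝕜]
  {EG : Type u} [AddCommGroup EG] [Module 𝕜 EG] [TopologicalSpace EG]
  [IsTopologicalAddGroup EG] [ContinuousSMul 𝕜 EG] [PolynormableSpace 𝕜 EG]
  {G : Type u} [Group G] [TopologicalSpace G] [ChartedSpace EG G] [LocConvLieGroup 𝕜 EG G]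
  {EN : Type v} [AddCommGroup EN] [Module 𝕜 EN] [TopologicalSpace EN]
  [IsTopologicalAddGroup EN] [ContinuousSMul 𝕜 EN] [PolynormableSpace 𝕜 EN]
  {N : Type v} [Group N] [TopologicalSpace N] [ChartedSpace EN N] [LocConvLieGroup 𝕜 EN N]

namespace FactorSystem

variable (f : FactorSystem 𝕜 EG G EN N)

/-- `U` is a symmetric open identity neighbourhood such that `ω` is smooth on `U × U` and the action
`(g, n) ↦ S(g)(n)` is smooth on `U × N`. -/
structure IsSmoothDomain (U : Set G) : Prop where
  isOpen : IsOpen U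
  one_mem : 1 ∈ U
  inv_mem : ∀ g ∈ U, g⁻¹ ∈ U
  smooth_ω : SmoothOnSet 𝕜 (EG × EG) EN f.ω (U ×ˢ U)
  smooth_S : SmoothOnSet 𝕜 (EG × EN) EN (fun p : G × N => f.S p.1 p.2) (U ×ˢ univ)

theorem exists_isSmoothDomain : ∃ U : Set G, f.IsSmoothDomain U := by
  obtain ⟨W, hW, h1W, hωW⟩ := f.isC2ss.1.2.2
  obtain ⟨V, hV, h1V, hSV⟩ := f.isC1Aut.locallySmooth
  obtain ⟨A, B, hA, hB, h1A, h1B, hAB⟩ := isOpen_prod_iff.1 hW 1 1 h1W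
  have hinv : Continuous (fun g : G => g⁻¹) := continuous_iff_continuousAt.2 fun g =>
    (LocConvLieGroup.smooth_inv (𝕜 := 𝕜) (E := EG) g).continuousAt
  have hO : IsOpen (A ∩ B ∩ V) := (hA.inter hB).inter hV
  refine ⟨(A ∩ B ∩ V) ∩ (fun g => g⁻¹) ⁻¹' (A ∩ B ∩ V), hO.inter (hO.preimage hinv), ?_, ?_,
    fun p hp => hωW p (hAB ⟨hp.1.1.1.1, hp.2.1.1.2⟩), fun p hp => hSV p ⟨hp.1.1.2, trivial⟩⟩
  · simp [h1A, h1B, h1V]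
  · rintro g ⟨hg, hg'⟩
    exact ⟨hg', by simpa using hg⟩

variable {f} {U : Set G} {E : Type*} [AddCommGroup E] [Module 𝕜 E] [TopologicalSpace E]
  [IsTopologicalAddGroup E] [ContinuousSMul 𝕜 E] {M : Type*} [TopologicalSpace M]
  [ChartedSpace E M] [SmoothManifold 𝕜 E M]

theorem IsSmoothDomain.smoothNear_ω (hU : f.IsSmoothDomain U) {a b : M → G} {x : M}
    (ha : SmoothNear 𝕜 E EG a x) (hb : SmoothNear 𝕜 E EG b x) (hax : a x ∈ U) (hbx : b x ∈ U) :
    SmoothNear 𝕜 E EN (fun y => f.ω (a y, b y)) x :=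
  SmoothNear.comp (F := EG × EG) (g := f.ω) (f := fun y => (a y, b y))
    (hU.smooth_ω _ ⟨hax, hbx⟩) (ha.prodMk hb)

theorem IsSmoothDomain.smoothNear_S (hU : f.IsSmoothDomain U) {a : M → G} {b : M → N} {x : M}
    (ha : SmoothNear 𝕜 E EG a x) (hb : SmoothNear 𝕜 E EN b x) (hax : a x ∈ U) :
    SmoothNear 𝕜 E EN (fun y => f.S (a y) (b y)) x :=
  SmoothNear.comp (F := EG × EN) (g := fun p : G × N => f.S p.1 p.2) (f := fun y => (a y, b y))
    (hU.smooth_S _ ⟨hax, trivial⟩) (ha.prodMk hb)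

variable (f U)

/-- The patch `N × U → N ×_(S,ω) G`, `(n, u) ↦ (n, u)(1, g)`. -/
def patch (g : G) : PartialEquiv (TwistedProduct f) (N × G) where
  toFun x := (x.fst * (f.ω (x.snd * g⁻¹, g))⁻¹, x.snd * g⁻¹)
  invFun p := ⟨p.1 * f.ω (p.2, g), p.2 * g⟩
  source := {x | x.snd * g⁻¹ ∈ U}
  target := {p | p.2 ∈ U}
  map_source' _ hx := hx
  map_target' p hp := by simpa using hp
  left_inv' x _ := by ext <;> simp
  right_inv' p _ := by ext <;> simp

variable {f U}

/-- The left side is the `N`-part of the transition between the patches at `g` and `g'`; it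
evaluates `ω` at points far from the identity. Two cocycle identities, for `(w, u₀, g)` and `(w, v,
g')` with `w = u u₀⁻¹`, share the term `ω(w, u₀ g) = ω(w, v g')`, which cancels. The remaining
dependence on `u` is through `w`, which is near 1 when `u` is near `u₀`, so smoothness follows as
soon as `u₀, v ∈ U`. -/
theorem patch_transition (u₀ u v g g' : G) (h : u₀ * g = v * g') :
    f.ω (u, g) * (f.ω (u * g * g'⁻¹, g'))⁻¹ = (f.ω (u * u₀⁻¹, u₀))⁻¹ *
      f.S (u * u₀⁻¹) (f.ω (u₀, g) * (f.ω (v, g'))⁻¹) * f.ω (u * u₀⁻¹, v) := by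
  have e1 := f.cocycle (u * u₀⁻¹) u₀ g
  have e2 := f.cocycle (u * u₀⁻¹) v g'
  have e3 : u * u₀⁻¹ * v = u * g * g'⁻¹ := by
    rw [eq_mul_inv_iff_mul_eq, mul_assoc, ← h]; simp [mul_assoc]
  rw [e3, ← h] at e2
  rw [inv_mul_cancel_right] at e1
  rw [map_mul, map_inv, eq_mul_inv_of_mul_eq e1, eq_mul_inv_of_mul_eq e2]
  group

theorem isOpen_patch_trans (hU : f.IsSmoothDomain U) (g g' : G) :
    IsOpen ((f.patch U g).symm.trans (f.patch U g')).source := by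
  have h : Continuous fun p : N × G => p.2 * g * g'⁻¹ := continuous_iff_continuousAt.2 fun p =>
    (((SmoothNear.snd (𝕜 := 𝕜) (E := EN) (F := EG) p).mul (SmoothNear.const g _)).mul
      (SmoothNear.const g'⁻¹ _)).continuousAt
  exact (hU.isOpen.preimage continuous_snd).inter (hU.isOpen.preimage h)

theorem smooth_patch_trans (hU : f.IsSmoothDomain U) (g g' : G) :
    SmoothOnSet 𝕜 (EN × EG) (EN × EG) ((f.patch U g).symm.trans (f.patch U g'))
      ((f.patch U g).symm.trans (f.patch U g')).source := by
  rintro ⟨n, u⟩ ⟨hu, hu'⟩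
  have hu : u ∈ U := hu
  have hu' : u * g * g'⁻¹ ∈ U := hu'
  have s1 := SmoothNear.fst (𝕜 := 𝕜) (E := EN) (F := EG) (n, u)
  have s2 := SmoothNear.snd (𝕜 := 𝕜) (E := EN) (F := EG) (n, u)
  -- This is the variable `w` of `patch_transition`, with base point `u₀ = u` and `v = u g g'⁻¹`.
  have hv : SmoothNear 𝕜 (EN × EG) EG (fun p : N × G => p.2 * u⁻¹) (n, u) :=
    s2.mul (SmoothNear.const _ _)
  have hv1 : u * u⁻¹ ∈ U := by simpa using hU.one_mem
  have h1 := (s1.mul (((hU.smoothNear_ω hv (SmoothNear.const u _) hv1 hu).inv.mul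
    (hU.smoothNear_S hv (SmoothNear.const (f.ω (u, g) * (f.ω (u * g * g'⁻¹, g'))⁻¹) _) hv1)).mul
    (hU.smoothNear_ω hv (SmoothNear.const (u * g * g'⁻¹) _) hv1 hu'))).prodMk
    ((s2.mul (SmoothNear.const g _)).mul (SmoothNear.const g'⁻¹ _))
  refine h1.congr (Eventually.of_forall fun p => ?_)
  refine Prod.ext ?_ rfl
  change _ = p.1 * f.ω (p.2, g) * (f.ω (p.2 * g * g'⁻¹, g'))⁻¹
  have e := patch_transition (f := f) u p.2 (u * g * g'⁻¹) g g' (by group)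
  exact (congrArg (p.1 * ·) e.symm).trans (mul_assoc _ _ _).symm

/-- Joint smoothness is assumed for `(u, n) ↦ S(u)(n)` only. Expressing the inverse through `S(u⁻¹)`
makes `(u, n) ↦ S(u)⁻¹(n)` jointly smooth over the symmetric set `U`; the local trivializations need
this. -/
theorem S_symm_apply (u : G) (n : N) :
    (f.S u).symm n = (f.ω (u⁻¹, u))⁻¹ * f.S u⁻¹ n * f.ω (u⁻¹, u) := by
  have h := f.mul_apply u⁻¹ u ((f.S u).symm n)
  rw [inv_mul_cancel, f.isC1Aut.map_one, MulEquiv.apply_symm_apply] at h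
  rw [h]
  simp [mul_assoc]

end FactorSystem

theorem TwistedProduct.mk_mul_mk {f : FactorSystem 𝕜 EG G EN N} (n n' : N) (g g' : G) :
    (⟨n, g⟩ * ⟨n', g'⟩ : TwistedProduct f) = ⟨n * f.S g n' * f.ω (g, g'), g * g'⟩ := rfl

/-- The bracketed factor is the map `x ↦ ω(g, x) ω(gxg⁻¹, g)⁻¹` from the definition of `C²_ss`, with
`g = y.snd`. Through this formula that condition makes conjugations smooth near 1. -/
theorem TwistedProduct.conj_mk {f : FactorSystem 𝕜 EG G EN N} (y x : TwistedProduct f) :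
    y * x * y⁻¹ = ⟨y.fst * f.S y.snd x.fst * (f.ω (y.snd, x.snd) *
      (f.ω (y.snd * x.snd * y.snd⁻¹, y.snd))⁻¹) * f.S (y.snd * x.snd * y.snd⁻¹) y.fst⁻¹,
      y.snd * x.snd * y.snd⁻¹⟩ := by
  rw [mul_inv_eq_iff_eq_mul]
  refine TwistedProduct.ext ?_ (by change _ = _ * y.snd; simp; rfl)
  change y.fst * f.S y.snd x.fst * f.ω (y.snd, x.snd) = _ * f.S (y.snd * x.snd * y.snd⁻¹) y.fst *
    f.ω (y.snd * x.snd * y.snd⁻¹, y.snd)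
  simp [mul_assoc]

variable [T2Space EG] [T2Space EN]

open FactorSystem in
/-- The group `N ×_(S,ω) G` carries a Lie group structure making it an extension. -/
theorem FactorSystem.nonempty_twistedLieStructure (f : FactorSystem 𝕜 EG G EN N) :
    Nonempty (TwistedLieStructure f) := by
  obtain ⟨U, hU⟩ := f.exists_isSmoothDomain
  obtain ⟨tT, cT, mT, hP⟩ := exists_smoothManifold_of_patches (𝕜 := 𝕜) (E := EN × EG)
    (f.patch U) (fun x => ⟨x.snd, by simpa [patch] using hU.one_mem⟩)
    (isOpen_patch_trans hU) (smooth_patch_trans hU)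
  have hω1 : ∀ g, f.ω (g, 1) = 1 := f.isC2ss.1.1
  have hω1' : ∀ g, f.ω (1, g) = 1 := f.isC2ss.1.2.1
  have hmem1 : ∀ {u : G}, u ∈ U → u * (1 : G)⁻¹ ∈ U := fun hu => by simpa using hu
  -- In the patch at `g = 1` the coordinates are the plain pair `(n, g)`, because `ω(g, 1) = 1`.
  have hfst : ∀ x : TwistedProduct f, x.snd ∈ U →
      SmoothNear 𝕜 (EN × EG) EN TwistedProduct.fst x := fun x hx => by
    have := SmoothNear.comp (F := EN × EG) (g := Prod.fst) (SmoothNear.fst _)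
      ((hP 1).2.1 x (hmem1 hx))
    simpa [patch, hω1] using this
  -- Any `x` lies in the patch at `x.snd`, since `1 ∈ U`; hence this holds everywhere and not only
  -- over `U`.
  have hsnd : SmoothMap 𝕜 (EN × EG) EG (TwistedProduct.snd (f := f)) := fun x => by
    have := (SmoothNear.comp (F := EN × EG) (g := Prod.snd) (SmoothNear.snd _)
      ((hP x.snd).2.1 x (by simpa [patch] using hU.one_mem))).mul (SmoothNear.const x.snd _)
    simpa [patch] using this
  have hmk : SmoothOnSet 𝕜 (EN × EG) (EN × EG)
      (fun p : N × G => (⟨p.1, p.2⟩ : TwistedProduct f)) (univ ×ˢ U) := fun p hp => by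
    have := (hP 1).2.2 p hp.2
    refine this.congr (Eventually.of_forall fun p => ?_)
    change (⟨_, _⟩ : TwistedProduct f) = _
    rw [hω1, mul_one, mul_one]
  have hmk' : ∀ {E M : Type (max u v)} [AddCommGroup E] [Module 𝕜 E] [TopologicalSpace E]
      [IsTopologicalAddGroup E] [ContinuousSMul 𝕜 E] [TopologicalSpace M] [ChartedSpace E M]
      [SmoothManifold 𝕜 E M] {a : M → N} {b : M → G} {x : M}, SmoothNear 𝕜 E EN a x →
      SmoothNear 𝕜 E EG b x → b x ∈ U →
      SmoothNear 𝕜 E (EN × EG) (fun y => (⟨a y, b y⟩ : TwistedProduct f)) x := by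
    intro E M _ _ _ _ _ _ _ _ a b x ha hb hbx
    exact SmoothNear.comp (F := EN × EG) (g := fun p : N × G => (⟨p.1, p.2⟩ : TwistedProduct f))
      (f := fun y => (a y, b y)) (hmk _ ⟨trivial, hbx⟩) (ha.prodMk hb)
  have hsymm : ∀ g n, SmoothNear 𝕜 EN EN (f.S g).symm n := fun g => (f.isC1Aut.lieAut g).2
  have hS : ∀ g n, SmoothNear 𝕜 EN EN (f.S g) n := fun g => (f.isC1Aut.lieAut g).1
  -- Right multiplication by `(m, h)` takes the patch at `g` to the patch at `gh`. In these
  -- coordinates it is `(n, u) ↦ (n S(u)(S(g)(m) ω(g, h)), u)`, where only `S` near 1 varies.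
  have hright : ∀ y : TwistedProduct f, SmoothMap 𝕜 (EN × EG) (EN × EG) (fun x => x * y) := by
    rintro ⟨m, h⟩ x
    set g := x.snd
    have hx : x ∈ (f.patch U g).source := by simpa [patch, g] using hU.one_mem
    have h0 := (hP g).2.1 x hx
    have h1 := SmoothNear.comp (F := EN × EG) (g := Prod.fst) (SmoothNear.fst _) h0
    have h2 := SmoothNear.comp (F := EN × EG) (g := Prod.snd) (SmoothNear.snd _) h0
    have h3 := (h1.mul (hU.smoothNear_S h2
      (SmoothNear.const (f.S g m * f.ω (g, h)) _) hx)).prodMk h2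
    refine (SmoothNear.comp (F := EN × EG) ((hP (g * h)).2.2 _ hx) h3).congr
      (Eventually.of_forall fun z => ?_)
    refine TwistedProduct.ext ?_ ?_
    · change z.fst * (f.ω (z.snd * g⁻¹, g))⁻¹ * f.S (z.snd * g⁻¹) (f.S g m * f.ω (g, h)) *
        f.ω (z.snd * g⁻¹, g * h) = z.fst * f.S z.snd m * f.ω (z.snd, h)
      have e := f.cocycle (z.snd * g⁻¹) g h
      rw [map_mul, f.mul_apply, eq_mul_inv_of_mul_eq e]
      simp [mul_assoc]
    · change z.snd * g⁻¹ * (g * h) = z.snd * h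
      group
  have hlie : LocConvLieGroup 𝕜 (EN × EG) (TwistedProduct f) := by
    refine LocConvLieGroup.of_smoothNear_one hright ?_ ?_ fun y => ?_
    · have f1 := SmoothNear.fst (𝕜 := 𝕜) (E := EN × EG) (F := EN × EG)
        ((1, 1) : TwistedProduct f × TwistedProduct f)
      have f2 := SmoothNear.snd (𝕜 := 𝕜) (E := EN × EG) (F := EN × EG)
        ((1, 1) : TwistedProduct f × TwistedProduct f)
      have a1 := (hfst 1 hU.one_mem).comp_of_eq f1 rfl
      have a2 := (hfst 1 hU.one_mem).comp_of_eq f2 rfl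
      have b1 := (hsnd 1).comp_of_eq f1 rfl
      have b2 := (hsnd 1).comp_of_eq f2 rfl
      exact hmk' ((a1.mul (hU.smoothNear_S b1 a2 hU.one_mem)).mul
        (hU.smoothNear_ω b1 b2 hU.one_mem hU.one_mem)) (b1.mul b2)
        (by change (1 : G) * 1 ∈ U; simpa using hU.one_mem)
    · have h1 : (1 : G)⁻¹ ∈ U := hU.inv_mem _ hU.one_mem
      exact hmk' ((hU.smoothNear_ω (hsnd 1).inv (hsnd 1) h1 hU.one_mem).inv.mul
        (hU.smoothNear_S (hsnd 1).inv (hfst 1 hU.one_mem).inv h1)) (hsnd 1).inv h1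
    · have hc : SmoothNear 𝕜 (EN × EG) EG
          (fun x : TwistedProduct f => y.snd * x.snd * y.snd⁻¹) 1 :=
        ((SmoothNear.const _ _).mul (hsnd 1)).mul (SmoothNear.const _ _)
      have hc1 : y.snd * (1 : TwistedProduct f).snd * y.snd⁻¹ ∈ U := by
        change y.snd * 1 * y.snd⁻¹ ∈ U
        simpa using hU.one_mem
      have hss := (locallySmoothAt_iff.1 (f.isC2ss.2 y.snd)).comp_of_eq (hsnd 1) rfl
      have hSf := SmoothNear.comp (hS y.snd _) (hfst 1 hU.one_mem)
      refine (hmk' ((((SmoothNear.const y.fst _).mul hSf).mul hss).mul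
        (hU.smoothNear_S hc (SmoothNear.const y.fst⁻¹ _) hc1)) hc hc1).congr
        (Eventually.of_forall fun x => (TwistedProduct.conj_mk y x).symm)
  have hext : IsLieExtension 𝕜 EG EN (EN × EG) (TwistedProduct.inl f) (TwistedProduct.proj f) := by
    refine ⟨fun n => ?_, hsnd, fun n n' h => congrArg TwistedProduct.fst h, ?_,
      fun g => ⟨⟨1, g⟩, rfl⟩, fun g => ?_⟩
    · exact SmoothNear.comp (F := EN × EG)
        (g := fun p : N × G => (⟨p.1, p.2⟩ : TwistedProduct f)) (f := fun n => (n, 1))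
        (hmk _ ⟨trivial, hU.one_mem⟩) ((SmoothNear.id n).prodMk (SmoothNear.const _ _))
    · ext x
      refine ⟨?_, fun hx => ⟨x.fst, TwistedProduct.ext rfl (Eq.symm hx)⟩⟩
      rintro ⟨n, rfl⟩
      exact rfl
    · have hg : ∀ y : G, SmoothNear 𝕜 EG EG (fun y => y * g⁻¹) y := fun y =>
        (SmoothNear.id y).mul (SmoothNear.const _ _)
      -- With `u = y g⁻¹`, the section is `(1, u)(1, g) = (ω(u, g), y)`. Solving `x = σ(q x) ι(t)`
      -- by means of `S(u) S(g) = C_N(ω(u, g)) S(ug)` gives `t = S(g)⁻¹ S(u)⁻¹ (x.fst ω(u, g)⁻¹)`,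
      -- whose argument is the `N`-coordinate of `x` in the patch at `g`.
      refine ⟨{y | y * g⁻¹ ∈ U}, hU.isOpen.preimage (continuous_iff_continuousAt.2 fun y =>
        (hg y).continuousAt), by simpa using hU.one_mem, fun y => ⟨f.ω (y * g⁻¹, g), y⟩,
        fun y hy => ?_, fun y _ => rfl, fun x => (f.S g).symm ((f.S (x.snd * g⁻¹)).symm
          (x.fst * (f.ω (x.snd * g⁻¹, g))⁻¹)), fun x hx => ?_, fun x hx => ?_⟩
      · refine (((hP g).2.2 (1, y * g⁻¹) hy).comp_of_eq
          ((SmoothNear.const (1 : N) y).prodMk (hg y)) rfl).congr (Eventually.of_forall fun z => ?_)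
        change (⟨_, _⟩ : TwistedProduct f) = _
        simp
      · have h0 := (hP g).2.1 x hx
        have h1 := SmoothNear.comp (F := EN × EG) (g := Prod.fst) (SmoothNear.fst _) h0
        have h2 := SmoothNear.comp (F := EN × EG) (g := Prod.snd) (SmoothNear.snd _) h0
        have h3 := hU.smoothNear_ω h2.inv h2 (hU.inv_mem _ hx) hx
        have h4 := (h3.inv.mul (hU.smoothNear_S h2.inv h1 (hU.inv_mem _ hx))).mul h3
        refine (SmoothNear.comp (hsymm g _) h4).congr (Eventually.of_forall fun z => ?_)
        simp only [S_symm_apply (z.snd * g⁻¹)]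
        rfl
      · refine TwistedProduct.ext ?_ (mul_one _).symm
        change x.fst = f.ω (x.snd * g⁻¹, g) * f.S x.snd ((f.S g).symm ((f.S (x.snd * g⁻¹)).symm
          (x.fst * (f.ω (x.snd * g⁻¹, g))⁻¹))) * f.ω (x.snd, 1)
        have e := f.mul_apply (x.snd * g⁻¹) g ((f.S g).symm ((f.S (x.snd * g⁻¹)).symm
          (x.fst * (f.ω (x.snd * g⁻¹, g))⁻¹)))
        rw [MulEquiv.apply_symm_apply, MulEquiv.apply_symm_apply, inv_mul_cancel_right] at e
        rw [hω1, mul_one, ← mul_right_cancel e]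
  exact ⟨{ model := EN × EG, isLieExtension := hext, smooth_mk := ⟨U, hU.isOpen, hU.one_mem, hmk⟩ }⟩

end TwistedLie

/-! ### Extensions, factor systems and their morphisms -/

section ExtensionClasses

set_option linter.unusedSectionVars false

variable {𝕜 : Type w} [RCLike 𝕜]
  {EG : Type u} [AddCommGroup EG] [Module 𝕜 EG] [TopologicalSpace EG]
  [IsTopologicalAddGroup EG] [ContinuousSMul 𝕜 EG] [PolynormableSpace 𝕜 EG]
  {G : Type u} [Group G] [TopologicalSpace G] [ChartedSpace EG G] [LocConvLieGroup 𝕜 EG G]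
  {EN : Type v} [AddCommGroup EN] [Module 𝕜 EN] [TopologicalSpace EN]
  [IsTopologicalAddGroup EN] [ContinuousSMul 𝕜 EN] [PolynormableSpace 𝕜 EN]
  {N : Type v} [Group N] [TopologicalSpace N] [ChartedSpace EN N] [LocConvLieGroup 𝕜 EN N]

section

variable {E : Type*} [AddCommGroup E] [Module 𝕜 E] [TopologicalSpace E]
  [IsTopologicalAddGroup E] [ContinuousSMul 𝕜 E] {M : Type*} [TopologicalSpace M]
  [ChartedSpace E M] [SmoothManifold 𝕜 E M]

/-- In an extension of Lie groups, `N` is an initial submanifold of the total group. -/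
theorem LieExtension.smoothNear_of_ι (X : LieExtension 𝕜 EG G EN N) {f : M → N} {x : M}
    (h : SmoothNear 𝕜 E X.model (fun y => X.ι (f y)) x) : SmoothNear 𝕜 E EN f x := by
  have hX := X.isLieExtension
  obtain ⟨V, -, h1V, ρ, -, -, τ, hτ, hτρ⟩ := hX.principal 1
  have hq : ∀ n, X.q (X.ι n) = 1 := fun n => by
    have : X.ι n ∈ X.q.ker := hX.exact ▸ ⟨n, rfl⟩
    exact this
  -- On the kernel of `q` the trivialization reads `x = ρ(1) ι(τ x)`. The unknown `ρ(1)` is removed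
  -- by comparing with `x = 1`, which leaves a smooth left inverse of `ι`.
  have key : ∀ n, (τ 1)⁻¹ * τ (X.ι n) = n := fun n => by
    apply hX.injective
    have e1 := hτρ 1 (by simpa using h1V)
    have e2 := hτρ (X.ι n) (by simpa [hq n] using h1V)
    rw [hq n] at e2
    rw [map_one] at e1
    rw [map_mul, map_inv, inv_mul_eq_iff_eq_mul]
    apply mul_left_cancel (a := ρ 1)
    rw [← e2, ← mul_assoc, ← e1, one_mul]
  have h1 : SmoothNear 𝕜 E EN (fun y => τ (X.ι (f y))) x :=
    SmoothNear.comp (F := X.model) (g := τ) (hτ _ (by simpa [hq] using h1V)) h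
  have h2 : SmoothNear 𝕜 E EN (fun y => (τ 1)⁻¹ * τ (X.ι (f y))) x :=
    (SmoothNear.const _ _).mul h1
  simpa only [key] using h2

theorem IsC1.smoothNear {h : G → N} (hh : IsC1 𝕜 EG EN h) : SmoothNear 𝕜 EG EN h 1 :=
  locallySmoothAt_iff.1 hh.2

namespace TwistedLieStructure

variable {f : FactorSystem 𝕜 EG G EN N} (L : TwistedLieStructure f)

theorem smoothNear_mk {a : M → N} {b : M → G} {x : M} (ha : SmoothNear 𝕜 E EN a x)
    (hb : SmoothNear 𝕜 E EG b x) (hbx : b x = 1) :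
    SmoothNear 𝕜 E L.toLieExtension.model (M' := L.toLieExtension.carrier)
      (fun y => (⟨a y, b y⟩ : TwistedProduct f)) x := by
  obtain ⟨U, -, h1U, hs⟩ := L.smooth_mk
  have h : SmoothNear 𝕜 (EN × EG) L.toLieExtension.model (M' := L.toLieExtension.carrier)
      (fun p : N × G => (⟨p.1, p.2⟩ : TwistedProduct f)) (a x, 1) := hs (a x, 1) ⟨trivial, h1U⟩
  exact h.comp_of_eq (f := fun y => (a y, b y)) (ha.prodMk hb) (by rw [hbx])

theorem smoothNear_snd (x : L.toLieExtension.carrier) :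
    SmoothNear 𝕜 L.toLieExtension.model EG
      (fun x : L.toLieExtension.carrier => TwistedProduct.snd (f := f) x) x :=
  L.toLieExtension.isLieExtension.smooth_q x

/-- Since `ι(x.fst) = x (1, x.snd)⁻¹` and `N` is initial in the total group, the first coordinate is
smooth near 1 for every admissible Lie structure. Together with `smoothNear_mk` this fixes the
structure near 1, so morphisms can be checked in the coordinates `(n, g)`. -/
theorem smoothNear_fst : SmoothNear 𝕜 L.toLieExtension.model EN
      (fun x : L.toLieExtension.carrier => TwistedProduct.fst (f := f) x) 1 := by
  refine L.toLieExtension.smoothNear_of_ι ?_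
  have h := (SmoothNear.id (𝕜 := 𝕜) (E := L.toLieExtension.model) (1 : L.toLieExtension.carrier)).mul
    (L.smoothNear_mk (SmoothNear.const (1 : N) _) (L.smoothNear_snd 1) rfl).inv
  refine h.congr (Eventually.of_forall fun x => ?_)
  have e : ∀ x : TwistedProduct f, x * (⟨1, x.snd⟩ : TwistedProduct f)⁻¹ = ⟨x.fst, 1⟩ := by
    intro x
    rw [mul_inv_eq_iff_eq_mul, TwistedProduct.mk_mul_mk]
    ext <;> simp [f.isC2ss.1.2.1]
  exact e x

end TwistedLieStructure

end

/-- `h` defines the morphism `N ×_(S,ω) G → N ×_(S',ω') G`, `(n, g) ↦ (n h(g), g)`. -/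
structure FactorSystem.Intertwines (f f' : FactorSystem 𝕜 EG G EN N) (h : G → N) : Prop where
  isC1 : IsC1 𝕜 EG EN h
  apply_mul : ∀ g n, f.S g n * h g = h g * f'.S g n
  mul_eq : ∀ g g', f.ω (g, g') * h (g * g') = h g * f'.S g (h g') * f'.ω (g, g')

/-- A morphism over `N` and `G` is determined by `φ(1, g) = (h(g), g)`, because `(n, g) = (n, 1)(1,
g)`. Multiplicativity on `(1, g)(n, 1)` and on `(1, g)(1, g')` gives the two equations for `h`, and
these suffice. The structures `L` and `L'` are arbitrary, so independence of the Lie structure is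
included. -/
theorem TwistedLieStructure.equivalent_iff {f f' : FactorSystem 𝕜 EG G EN N}
    (L : TwistedLieStructure f) (L' : TwistedLieStructure f') :
    L.toLieExtension.Equivalent L'.toLieExtension ↔ ∃ h, f.Intertwines f' h := by
  have hω1 : ∀ (f : FactorSystem 𝕜 EG G EN N) g, f.ω (g, 1) = 1 := fun f => f.isC2ss.1.1
  have hω1' : ∀ (f : FactorSystem 𝕜 EG G EN N) g, f.ω (1, g) = 1 := fun f => f.isC2ss.1.2.1
  have hS1 : ∀ (f : FactorSystem 𝕜 EG G EN N), f.S 1 = 1 := fun f => f.isC1Aut.map_one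
  constructor
  · rintro ⟨φ, hφ, hι, hq⟩
    let ψ : TwistedProduct f →* TwistedProduct f' := φ
    have hψι : ∀ n, ψ ⟨n, 1⟩ = ⟨n, 1⟩ := hι
    have hψq : ∀ x, (ψ x).snd = x.snd := hq
    have hmk : ∀ n g, ψ ⟨n, g⟩ = ⟨n * (ψ ⟨1, g⟩).fst, g⟩ := by
      intro n g
      have e : (⟨n, g⟩ : TwistedProduct f) = ⟨n, 1⟩ * ⟨1, g⟩ := by
        rw [TwistedProduct.mk_mul_mk]
        ext <;> simp [hω1']
      have e' : ψ ⟨1, g⟩ = ⟨(ψ ⟨1, g⟩).fst, g⟩ := TwistedProduct.ext rfl (hψq _)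
      rw [e, map_mul, hψι]
      conv_lhs => rw [e', TwistedProduct.mk_mul_mk]
      ext <;> simp [hω1', hS1]
    refine ⟨fun g => (ψ ⟨1, g⟩).fst, ⟨?_, locallySmoothAt_iff.2 ?_⟩, fun g n => ?_, fun g g' => ?_⟩
    · exact congrArg TwistedProduct.fst (hψι 1)
    · have h1 := L.smoothNear_mk (SmoothNear.const (1 : N) (1 : G)) (SmoothNear.id (1 : G)) rfl
      have h2 := SmoothNear.comp (F := L.toLieExtension.model) (hφ _) h1
      exact L'.smoothNear_fst.comp_of_eq h2 (hψι 1)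
    · have e : ψ (⟨1, g⟩ * ⟨n, 1⟩) = ψ ⟨1, g⟩ * ψ ⟨n, 1⟩ := map_mul _ _ _
      rw [hψι, TwistedProduct.mk_mul_mk, hmk, hmk 1 g, TwistedProduct.mk_mul_mk] at e
      simpa [hω1] using congrArg TwistedProduct.fst e
    · have e : ψ (⟨1, g⟩ * ⟨1, g'⟩) = ψ ⟨1, g⟩ * ψ ⟨1, g'⟩ := map_mul _ _ _
      rw [TwistedProduct.mk_mul_mk, hmk, hmk 1 g, hmk 1 g', TwistedProduct.mk_mul_mk] at e
      simpa using congrArg TwistedProduct.fst e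
  · rintro ⟨h, hh, hS, hω⟩
    let ψ : TwistedProduct f →* TwistedProduct f' := MonoidHom.mk'
      (fun x => ⟨x.fst * h x.snd, x.snd⟩) fun x y => by
        refine TwistedProduct.ext ?_ rfl
        change x.fst * f.S x.snd y.fst * f.ω (x.snd, y.snd) * h (x.snd * y.snd) =
          x.fst * h x.snd * f'.S x.snd (y.fst * h y.snd) * f'.ω (x.snd, y.snd)
        simp only [mul_assoc, hω, map_mul]
        rw [← mul_assoc (f.S _ _), hS]
        simp only [mul_assoc]
    let φ : L.toLieExtension.carrier →* L'.toLieExtension.carrier := ψ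
    refine ⟨φ, smoothMap_of_smoothNear_one φ ?_, fun n => ?_, fun x => rfl⟩
    · exact L'.smoothNear_mk (L.smoothNear_fst.mul (hh.smoothNear.comp_of_eq (L.smoothNear_snd 1) rfl))
        (L.smoothNear_snd 1) rfl
    · exact TwistedProduct.ext (by change n * h 1 = n; rw [hh.1, mul_one]) rfl

theorem IsTwistedClass.eq_iff {f f' : FactorSystem 𝕜 EG G EN N} {e e' : ExtClasses 𝕜 EG G EN N}
    (h : IsTwistedClass f e) (h' : IsTwistedClass f' e') :
    e = e' ↔ ∃ h, f.Intertwines f' h := by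
  obtain ⟨L, rfl⟩ := h
  obtain ⟨L', rfl⟩ := h'
  rw [← L.equivalent_iff L']
  exact Quotient.eq

theorem IsC1.one : IsC1 𝕜 EG EN (1 : G → N) :=
  ⟨rfl, locallySmoothAt_iff.2 (SmoothNear.const _ _)⟩

theorem FactorSystem.intertwines_one {f f' : FactorSystem 𝕜 EG G EN N} (hS : f.S = f'.S)
    (hω : ∀ p, f.ω p = f'.ω p) : f.Intertwines f' 1 :=
  ⟨IsC1.one, fun g n => by simp [hS], fun g g' => by simp [hω]⟩

theorem IsTwistedClass.of_eq {f f' : FactorSystem 𝕜 EG G EN N} {e e' : ExtClasses 𝕜 EG G EN N}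
    (h : IsTwistedClass f e) (h' : IsTwistedClass f' e') (hS : f.S = f'.S)
    (hω : ∀ p, f.ω p = f'.ω p) : e = e' :=
  (h.eq_iff h').2 ⟨1, FactorSystem.intertwines_one hS hω⟩

/-- The section `g ↦ (1, g)` induces exactly `f.S`. -/
theorem IsTwistedClass.mem_extKernel {f : FactorSystem 𝕜 EG G EN N} {e : ExtClasses 𝕜 EG G EN N}
    (h : IsTwistedClass f e) {S : G → MulAut N} (hS : OuterEquiv 𝕜 EG EN S f.S) :
    e ∈ ExtKernel 𝕜 EG EN S := by
  obtain ⟨L, rfl⟩ := h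
  refine ⟨_, rfl, fun g => (⟨1, g⟩ : TwistedProduct f), ⟨rfl, locallySmoothAt_iff.2 ?_⟩,
    fun g => rfl, f.S, fun g n => ?_, hS⟩
  · exact L.smoothNear_mk (SmoothNear.const (1 : N) (1 : G)) (SmoothNear.id (1 : G)) rfl
  · have e : (⟨f.S g n, 1⟩ : TwistedProduct f) = ⟨1, g⟩ * ⟨n, 1⟩ * (⟨1, g⟩ : TwistedProduct f)⁻¹ := by
      rw [eq_mul_inv_iff_mul_eq, TwistedProduct.mk_mul_mk, TwistedProduct.mk_mul_mk]
      ext <;> simp [f.isC2ss.1.1, f.isC2ss.1.2.1]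
    exact e

/-! ### Every extension of the kernel comes from a factor system -/

section Hausdorff

variable [T2Space EG] [T2Space EN]

theorem FactorSystem.exists_isTwistedClass (f : FactorSystem 𝕜 EG G EN N) :
    ∃ e, IsTwistedClass f e :=
  ⟨_, f.nonempty_twistedLieStructure.some, rfl⟩

/-- A normalized locally smooth section `ρ` of an extension inducing `S` defines a smooth factor
system `(S, ω)` with `ι(ω(g, g')) = ρ(g) ρ(g') ρ(gg')⁻¹`. -/
theorem LieExtension.exists_factorSystem (X : LieExtension 𝕜 EG G EN N) {S : G → MulAut N}
    (hS : IsC1Aut 𝕜 EG EN S) {ρ : G → X.carrier} (hρ : IsC1 𝕜 EG X.model ρ)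
    (hqρ : ∀ g, X.q (ρ g) = g) (hSρ : ∀ g n, X.ι (S g n) = ρ g * X.ι n * (ρ g)⁻¹) :
    ∃ f : FactorSystem 𝕜 EG G EN N, f.S = S ∧ IsTwistedClass f ⟦X⟧ := by
  have hX := X.isLieExtension
  have hρs : SmoothNear 𝕜 EG X.model ρ 1 := locallySmoothAt_iff.1 hρ.2
  have hker : ∀ p : G × G, ∃ n, X.ι n = ρ p.1 * ρ p.2 * (ρ (p.1 * p.2))⁻¹ := fun p => by
    have : ρ p.1 * ρ p.2 * (ρ (p.1 * p.2))⁻¹ ∈ X.q.ker := by simp [MonoidHom.mem_ker, hqρ]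
    rwa [← hX.exact] at this
  choose ω hω using hker
  let f : FactorSystem 𝕜 EG G EN N :=
    { S := S
      ω := ω
      isC1Aut := hS
      isC2ss := by
        refine isC2ss_iff.2 ⟨fun g => hX.injective ?_, fun g => hX.injective ?_,
          X.smoothNear_of_ι ?_, fun g => X.smoothNear_of_ι ?_⟩
        · simp [hω, hρ.1]
        · simp [hω, hρ.1]
        · have s1 := SmoothNear.fst (𝕜 := 𝕜) (E := EG) (F := EG) (1 : G × G)
          have s2 := SmoothNear.snd (𝕜 := 𝕜) (E := EG) (F := EG) (1 : G × G)
          simp only [hω]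
          exact ((hρs.comp_of_eq s1 rfl).mul (hρs.comp_of_eq s2 rfl)).mul
            (hρs.comp_of_eq (s1.mul s2) (by simp)).inv
        · have hc : SmoothNear 𝕜 EG EG (fun x => g * x * g⁻¹) 1 :=
            ((SmoothNear.const g _).mul (SmoothNear.id 1)).mul (SmoothNear.const g⁻¹ _)
          -- In `ω(g, x) ω(gxg⁻¹, g)⁻¹` the factors `ρ(gx)`, not known to be smooth near `x = 1`,
          -- cancel. What remains involves `ρ` only near 1 and at the constant `g`.
          have h1 : SmoothNear 𝕜 EG X.model
              (fun x => ρ g * ρ x * (ρ g)⁻¹ * (ρ (g * x * g⁻¹))⁻¹) 1 :=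
            (((SmoothNear.const _ _).mul hρs).mul (SmoothNear.const _ _)).mul
              (hρs.comp_of_eq hc (by simp)).inv
          refine h1.congr (Eventually.of_forall fun x => ?_)
          simp only [map_mul, map_inv, hω, inv_mul_cancel_right]
          group
      delta_eq := fun g g' => by
        rw [deltaAut, mul_inv_eq_iff_eq_mul]
        ext n
        apply hX.injective
        simp only [MulAut.mul_apply, MulAut.conj_apply, hSρ, map_mul, map_inv, hω]
        group
      d2_eq := fun g g' g'' => by
        apply hX.injective
        simp only [d2, hSρ, map_mul, map_inv, hω, map_one, mul_assoc g g' g'']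
        group }
  obtain ⟨e, L, rfl⟩ := f.exists_isTwistedClass
  refine ⟨f, rfl, L, Quotient.sound ?_⟩
  let ψ : TwistedProduct f →* X.carrier := MonoidHom.mk' (fun x => X.ι x.fst * ρ x.snd)
    fun x y => by
      change X.ι (x.fst * S x.snd y.fst * ω (x.snd, y.snd)) * ρ (x.snd * y.snd) = _
      simp only [hSρ, map_mul, hω]
      group
  let φ : L.toLieExtension.carrier →* X.carrier := ψ
  refine ⟨φ, smoothMap_of_smoothNear_one φ ?_, fun n => ?_, fun x => ?_⟩
  · exact (SmoothNear.comp (F := EN) (hX.smooth_ι _) L.smoothNear_fst).mul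
      (hρs.comp_of_eq (L.smoothNear_snd 1) rfl)
  · change X.ι n * ρ 1 = X.ι n
    rw [hρ.1, mul_one]
  · change X.q (X.ι (TwistedProduct.fst (f := f) x) * ρ (TwistedProduct.snd (f := f) x)) =
      TwistedProduct.snd (f := f) x
    have h : X.ι (TwistedProduct.fst (f := f) x) ∈ X.q.ker := hX.exact ▸ ⟨_, rfl⟩
    rw [map_mul, hqρ, MonoidHom.mem_ker.1 h, one_mul]

/-- Every class in `Ext(G, N)_[S]` is of the form `[N ×_(S,ω) G]`. -/
theorem exists_factorSystem_of_mem_extKernel {S : G → MulAut N} (hS : IsC1Aut 𝕜 EG EN S)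
    {e : ExtClasses 𝕜 EG G EN N} (he : e ∈ ExtKernel 𝕜 EG EN S) :
    ∃ f : FactorSystem 𝕜 EG G EN N, f.S = S ∧ IsTwistedClass f e := by
  obtain ⟨X, rfl, σ, hσ, hσq, S', hS', k, hk, hkS⟩ := he
  -- As `σ` induces `C_N(k) S`, dividing by `ι(k)` yields a section inducing `S` itself.
  refine X.exists_factorSystem hS (ρ := fun g => (X.ι (k g))⁻¹ * σ g)
    ⟨by simp [hk.1, hσ.1], locallySmoothAt_iff.2 ?_⟩ (fun g => ?_) fun g n => ?_
  · exact (SmoothNear.comp (F := EN) (X.isLieExtension.smooth_ι _) hk.smoothNear).inv.mul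
      (locallySmoothAt_iff.1 hσ.2)
  · have h : X.ι (k g) ∈ X.q.ker := X.isLieExtension.exact ▸ ⟨_, rfl⟩
    rw [map_mul, map_inv, hσq, MonoidHom.mem_ker.1 h, inv_one, one_mul]
  · have h := hS' g n
    rw [hkS, MulAut.mul_apply, MulAut.conj_apply, map_mul, map_mul, map_inv] at h
    rw [mul_inv_eq_iff_eq_mul, ← eq_inv_mul_iff_mul_eq] at h
    rw [h]
    group

end Hausdorff

/-! ### Twisting by central cocycles -/

section Twist

variable {S : G → MulAut N}

/-- The central factor `β` passes through `h`, so the same `h` works. This makes the twist of a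
class independent of the factor system representing it. -/
theorem FactorSystem.Intertwines.twist {f f' : FactorSystem 𝕜 EG G EN N} {h : G → N}
    (H : f.Intertwines f' h) (hf : OuterEquiv 𝕜 EG EN S f.S) (hf' : OuterEquiv 𝕜 EG EN S f'.S)
    (β : Z2ss 𝕜 EG EN S) : (f.twist hf β).Intertwines (f'.twist hf' β) h := by
  refine ⟨H.isC1, H.apply_mul, fun g g' => ?_⟩
  change f.ω (g, g') * (β.1 (g, g') : N) * h (g * g') =
    h g * f'.S g (h g') * (f'.ω (g, g') * (β.1 (g, g') : N))
  rw [mul_assoc, ← Subgroup.mem_center_iff.1 (β.1 (g, g')).2 (h (g * g')), ← mul_assoc, H.mul_eq]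
  simp only [mul_assoc]

/-- Pointwise form of the intertwining equation for a central `h`, with `c₁ = h(g)`, `c₂ =
S(g)(h(g'))` and `c₁₂ = h(gg')`. The right side is arranged as `d_S(h⁻¹)`, so the cochain that
appears is `h⁻¹`. -/
theorem central_twist_iff (ω : N) (β β' c₁ c₂ c₁₂ : Subgroup.center N) :
    ω * β * c₁₂ = c₁ * c₂ * (ω * β' : N) ↔ β⁻¹ * β' = c₂⁻¹ * (c₁₂⁻¹)⁻¹ * c₁⁻¹ := by
  have e1 : (c₁ * c₂ * (ω * β') : N) = ω * (c₁ * c₂ * β' : Subgroup.center N) := by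
    have := Subgroup.mem_center_iff.1 (c₁ * c₂).2 ω
    rw [Subgroup.coe_mul] at this
    rw [← mul_assoc, ← this]
    simp [mul_assoc]
  rw [e1, mul_assoc, mul_right_inj, ← Subgroup.coe_mul, Subtype.coe_inj, inv_mul_eq_iff_eq_mul,
    inv_inv]
  constructor
  · intro h
    rw [← inv_mul_eq_iff_eq_mul.2 h]
    simp only [mul_inv, mul_comm, mul_left_comm, mul_assoc]
  · intro h
    have e2 : c₁ * c₂ * (β * (c₂⁻¹ * c₁₂ * c₁⁻¹)) = c₁ * c₁⁻¹ * (c₂ * c₂⁻¹) * (β * c₁₂) := by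
      simp only [mul_comm, mul_left_comm, mul_assoc]
    rw [h, e2, mul_inv_cancel, mul_inv_cancel, one_mul, one_mul]

/-- Twisting by two cocycles gives equivalent extensions iff the cocycles are cohomologous. -/
theorem FactorSystem.exists_intertwines_twist_iff (f : FactorSystem 𝕜 EG G EN N)
    (hf : OuterEquiv 𝕜 EG EN S f.S) (β β' : Z2ss 𝕜 EG EN S) :
    (∃ h, (f.twist hf β).Intertwines (f.twist hf β') h) ↔
      (β : G × G → Subgroup.center N)⁻¹ * β' ∈ B2s 𝕜 EG EN S := by
  have hd : ∀ (c : G → Subgroup.center N) g g',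
      (d1 S (fun g => ((c g)⁻¹ : Subgroup.center N).1) g g' : N) =
        ((centerMap (S g) (c g'))⁻¹ * ((c (g * g'))⁻¹)⁻¹ * (c g)⁻¹ : Subgroup.center N) := by
    intro c g g'
    simp [d1, centerMap]
  have hfS : ∀ g (z : Subgroup.center N), f.S g z = centerMap (S g) z := fun g z =>
    hf.eq_on_center g z.2
  constructor
  · rintro ⟨h, H⟩
    -- Both twists have the same `S`, so `h(g)` commutes with the image of `S(g)`, which is all of
    -- `N`.
    have hc : ∀ g, h g ∈ Subgroup.center N := fun g => Subgroup.mem_center_iff.2 fun n => by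
      obtain ⟨m, rfl⟩ := (f.S g).surjective n
      exact H.apply_mul g m
    let c : G → Subgroup.center N := fun g => ⟨h g, hc g⟩
    refine ⟨fun g => (c g)⁻¹, ⟨by simp [c, H.isC1.1], locallySmoothAt_iff.2 ?_⟩, fun g g' => ?_⟩
    · exact H.isC1.smoothNear.inv
    · rw [hd]
      refine congrArg Subtype.val ((central_twist_iff (f.ω (g, g')) _ _ _ _ _).1 ?_)
      rw [← hfS]
      exact H.mul_eq g g'
  · rintro ⟨α, hα, hβ⟩
    refine ⟨fun g => ((α g)⁻¹ : Subgroup.center N), ⟨by simp [hα.1], locallySmoothAt_iff.2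
      hα.smoothNear.inv⟩, fun g n => Subgroup.mem_center_iff.1 ((α g)⁻¹).2 _, fun g g' => ?_⟩
    have h1 := hd (fun g => (α g)⁻¹) g g'
    simp only [inv_inv (α _)] at h1
    have h2 := (central_twist_iff (f.ω (g, g')) (β.1 (g, g')) (β'.1 (g, g')) (α g)⁻¹
      (centerMap (S g) (α g')⁻¹) (α (g * g'))⁻¹).2 (Subtype.ext ((hβ g g').trans (by
        simpa only [inv_inv] using h1)))
    rw [← hfS] at h2
    exact h2

/-- For `β = ω' ω⁻¹` this identifies the `C²_ss` expression of `β` with the quotient of those of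
`ω'` and `ω`. -/
theorem mul_inv_mul_inv_of_central (a b a' b' : N) (h : b' * b⁻¹ ∈ Subgroup.center N) :
    a' * b'⁻¹ * (a * b⁻¹)⁻¹ = a' * a⁻¹ * (b' * b⁻¹)⁻¹ := by
  have hz := Subgroup.mem_center_iff.1 (inv_mem h)
  have e : (b' * b⁻¹)⁻¹ = b'⁻¹ * b := by
    rw [eq_inv_mul_iff_mul_eq, hz]
    simp
  rw [mul_assoc a' a⁻¹, hz, e]
  simp [mul_assoc]

/-- The difference of two smooth factor systems over the same `S` is a cocycle. -/
theorem FactorSystem.exists_difference {f f' : FactorSystem 𝕜 EG G EN N} (hf : f.S = S)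
    (hf' : f'.S = S) : ∃ β ∈ Z2ss 𝕜 EG EN S, ∀ p, (β p : N) = f'.ω p * (f.ω p)⁻¹ := by
  have hc : ∀ p, f'.ω p * (f.ω p)⁻¹ ∈ Subgroup.center N := by
    rintro ⟨g, g'⟩
    refine Subgroup.mem_center_iff.2 fun n => ?_
    -- Both sides equal `δ_S(g, g')`; elements with equal inner automorphisms differ by the centre.
    have h : MulAut.conj (f.ω (g, g')) = MulAut.conj (f'.ω (g, g')) := by
      rw [← f.delta_eq, ← f'.delta_eq, hf, hf']
    have h := DFunLike.congr_fun h ((f.ω (g, g'))⁻¹ * n * f.ω (g, g'))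
    simp only [MulAut.conj_apply] at h
    rw [eq_mul_inv_iff_mul_eq] at h
    simp only [mul_assoc, mul_inv_cancel_left, mul_inv_cancel, mul_one] at h ⊢
    rw [← mul_assoc n, h]
    simp [mul_assoc]
  have hmul : ∀ p, f'.ω p = f.ω p * (f'.ω p * (f.ω p)⁻¹) := fun p => by
    rw [Subgroup.mem_center_iff.1 (hc p), inv_mul_cancel_right]
  refine ⟨fun p => ⟨_, hc p⟩, ⟨isC2ss_iff.2 ⟨fun g => ?_, fun g => ?_, ?_, fun g => ?_⟩,
    fun g g' g'' => ?_⟩, fun p => rfl⟩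
  · simp [f.isC2ss.1.1, f'.isC2ss.1.1]
  · simp [f.isC2ss.1.2.1, f'.isC2ss.1.2.1]
  · exact (isC2ss_iff.1 f'.isC2ss).2.2.1.mul (isC2ss_iff.1 f.isC2ss).2.2.1.inv
  · refine (((isC2ss_iff.1 f'.isC2ss).2.2.2 g).mul
      ((isC2ss_iff.1 f.isC2ss).2.2.2 g).inv).congr (Eventually.of_forall fun x => ?_)
    exact mul_inv_mul_inv_of_central _ _ _ _ (hc (g * x * g⁻¹, g))
  · have h1 := f.d2_eq g g' g''
    have h2 := f'.d2_eq g g' g''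
    rw [hf] at h1
    rw [hf'] at h2
    obtain ⟨β, hβ⟩ : ∃ β : G × G → N, ∀ p, f'.ω p * (f.ω p)⁻¹ = β p := ⟨_, fun _ => rfl⟩
    simp only [hβ] at hc hmul ⊢
    unfold d2 at *
    -- Writing `ω' = ω β` with `β` central splits `d_S ω'` as `d_S ω · d_S β`; the first two are
    -- trivial, hence so is the third.
    simp only [hmul, map_mul] at h2
    rw [central_rearrange _ _ _ _ _ _ _ _
      (Subgroup.mem_center_iff.1 (map_center (S g) (hc _))) (Subgroup.mem_center_iff.1 (hc _))
      (Subgroup.mem_center_iff.1 (inv_mem (hc _))) (Subgroup.mem_center_iff.1 (inv_mem (hc _))),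
      h1, one_mul] at h2
    exact h2

end Twist

end ExtensionClasses

/-! ### The action of `H²_ss` on the extension classes -/

section Main

set_option linter.unusedSectionVars false

variable {𝕜 : Type w} [RCLike 𝕜]
  {EG : Type u} [AddCommGroup EG] [Module 𝕜 EG] [TopologicalSpace EG]
  [IsTopologicalAddGroup EG] [ContinuousSMul 𝕜 EG] [PolynormableSpace 𝕜 EG] [T2Space EG]
  {G : Type u} [Group G] [TopologicalSpace G] [ChartedSpace EG G] [LocConvLieGroup 𝕜 EG G]
  {EN : Type v} [AddCommGroup EN] [Module 𝕜 EN] [TopologicalSpace EN]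
  [IsTopologicalAddGroup EN] [ContinuousSMul 𝕜 EN] [PolynormableSpace 𝕜 EN] [T2Space EN]
  {N : Type v} [Group N] [TopologicalSpace N] [ChartedSpace EN N] [LocConvLieGroup 𝕜 EN N]
  {S : G → MulAut N}

theorem OuterEquiv.of_eq {S S' : G → MulAut N} (h : S' = S) : OuterEquiv 𝕜 EG EN S S' :=
  ⟨1, IsC1.one, fun g => by simp [h]⟩

/-- Twisting equivalent extensions gives equivalent extensions iff the cocycles are cohomologous. -/
theorem IsTwistedClass.twist_eq_iff {f f' : FactorSystem 𝕜 EG G EN N}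
    {e c c' : ExtClasses 𝕜 EG G EN N} (h : IsTwistedClass f e) (h' : IsTwistedClass f' e)
    {hf : OuterEquiv 𝕜 EG EN S f.S} {hf' : OuterEquiv 𝕜 EG EN S f'.S} {β β' : Z2ss 𝕜 EG EN S}
    (hc : IsTwistedClass (f.twist hf β) c) (hc' : IsTwistedClass (f'.twist hf' β') c') :
    c = c' ↔ (QuotientGroup.mk β : H2ss 𝕜 EG EN S) = QuotientGroup.mk β' := by
  -- The same `k` intertwines the twists by `β'`, so `f'` can be replaced by `f` and the comparison
  -- is between two twists of one factor system.
  obtain ⟨k, hk⟩ := (h.eq_iff h').1 rfl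
  obtain ⟨d, hd⟩ := (f.twist hf β').exists_isTwistedClass
  have hdc : d = c' := (hd.eq_iff hc').2 ⟨k, hk.twist hf hf' β'⟩
  rw [← hdc, hc.eq_iff hd, f.exists_intertwines_twist_iff, QuotientGroup.eq,
    Subgroup.mem_subgroupOf]
  rfl

theorem IsTwistedClass.twist_one {f : FactorSystem 𝕜 EG G EN N} {e : ExtClasses 𝕜 EG G EN N}
    (h : IsTwistedClass f e) (hf : OuterEquiv 𝕜 EG EN S f.S) : IsTwistedClass (f.twist hf 1) e := by
  obtain ⟨d, hd⟩ := (f.twist hf 1).exists_isTwistedClass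
  rwa [h.of_eq hd rfl fun p => (mul_one _).symm]

/-- Here `ω' = ω β`, since `β` is central; combined with `exists_difference` this gives
transitivity. -/
theorem IsTwistedClass.twist_of_eq_mul {f f' : FactorSystem 𝕜 EG G EN N}
    {e' : ExtClasses 𝕜 EG G EN N} (h' : IsTwistedClass f' e') (hS : f.S = f'.S)
    (hf : OuterEquiv 𝕜 EG EN S f.S) {β : Z2ss 𝕜 EG EN S}
    (hβ : ∀ p, (β.1 p : N) = f'.ω p * (f.ω p)⁻¹) : IsTwistedClass (f.twist hf β) e' := by
  obtain ⟨d, hd⟩ := (f.twist hf β).exists_isTwistedClass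
  rwa [h'.of_eq hd hS.symm fun p => ?_]
  change f'.ω p = f.ω p * (β.1 p : N)
  rw [Subgroup.mem_center_iff.1 (β.1 p).2, hβ, inv_mul_cancel_right]

theorem IsTwistedClass.twist_twist {f : FactorSystem 𝕜 EG G EN N} {e : ExtClasses 𝕜 EG G EN N}
    (hf : OuterEquiv 𝕜 EG EN S f.S) {β β' : Z2ss 𝕜 EG EN S}
    (h : IsTwistedClass (f.twist hf (β * β')) e) :
    IsTwistedClass ((f.twist hf β').twist hf β) e := by
  obtain ⟨d, hd⟩ := ((f.twist hf β').twist hf β).exists_isTwistedClass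
  rwa [h.of_eq hd rfl fun p => ?_]
  change f.ω p * ((β * β').1 p : N) = f.ω p * (β'.1 p : N) * (β.1 p : N)
  rw [mul_comm β β', mul_assoc]
  rfl

theorem exists_representative (hS : IsC1Aut 𝕜 EG EN S) (e : ExtKernel 𝕜 EG EN S) :
    ∃ f : FactorSystem 𝕜 EG G EN N, f.S = S ∧ IsTwistedClass f e.1 :=
  exists_factorSystem_of_mem_extKernel hS e.2

theorem exists_twist_mem (f : FactorSystem 𝕜 EG G EN N) (hf : OuterEquiv 𝕜 EG EN S f.S)
    (β : Z2ss 𝕜 EG EN S) : ∃ e : ExtKernel 𝕜 EG EN S, IsTwistedClass (f.twist hf β) e.1 := by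
  obtain ⟨e, he⟩ := (f.twist hf β).exists_isTwistedClass
  exact ⟨⟨e, he.mem_extKernel hf⟩, he⟩

/-- The action `[β] • [N ×_(S',ω) G] = [N ×_(S',ω·β) G]` of `H²_ss(G, Z(N))_[S]` on
`Ext(G, N)_[S]`. -/
theorem exists_twistAction (hS : IsC1Aut 𝕜 EG EN S) :
    ∃ act : MulAction (H2ss 𝕜 EG EN S) (ExtKernel 𝕜 EG EN S),
      ∀ (f : FactorSystem 𝕜 EG G EN N) (hf : OuterEquiv 𝕜 EG EN S f.S) (β : Z2ss 𝕜 EG EN S)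
        (e e' : ExtKernel 𝕜 EG EN S), IsTwistedClass f e.1 → IsTwistedClass (f.twist hf β) e'.1 →
          act.smul (QuotientGroup.mk β) e = e' := by
  choose rep hrepS hrep using exists_representative hS
  -- The action is defined through an arbitrary factor system over `S` and an arbitrary cocycle in
  -- the class; `key` removes both choices.
  choose tw htw using fun (b : H2ss 𝕜 EG EN S) (e : ExtKernel 𝕜 EG EN S) =>
    exists_twist_mem (rep e) (OuterEquiv.of_eq (hrepS e)) b.out
  have key : ∀ (f : FactorSystem 𝕜 EG G EN N) (hf : OuterEquiv 𝕜 EG EN S f.S) (β : Z2ss 𝕜 EG EN S)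
      (e e' : ExtKernel 𝕜 EG EN S), IsTwistedClass f e.1 → IsTwistedClass (f.twist hf β) e'.1 →
        tw (QuotientGroup.mk β) e = e' := fun f hf β e e' he he' =>
    Subtype.ext (((hrep e).twist_eq_iff he (htw _ e) he').2 (QuotientGroup.out_eq' _))
  refine ⟨{ smul := tw, mul_smul := fun b b' e => ?_, one_smul := fun e => ?_ }, key⟩
  · obtain ⟨β, rfl⟩ := QuotientGroup.mk_surjective b
    obtain ⟨β', rfl⟩ := QuotientGroup.mk_surjective b'
    have hf := OuterEquiv.of_eq (𝕜 := 𝕜) (EG := EG) (EN := EN) (hrepS e)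
    obtain ⟨c, hc⟩ := exists_twist_mem (rep e) hf β'
    obtain ⟨d, hd⟩ := exists_twist_mem (rep e) hf (β * β')
    have h1 : tw (QuotientGroup.mk β') e = c := key _ hf _ _ _ (hrep e) hc
    have h2 : tw (QuotientGroup.mk (β * β')) e = d := key _ hf _ _ _ (hrep e) hd
    -- The class `c` is computed from `(rep e).twist hf β'` instead of its chosen representative,
    -- which `key` permits.
    have h3 : tw (QuotientGroup.mk β) c = d :=
      key ((rep e).twist hf β') hf _ _ _ hc (hd.twist_twist hf)
    change tw (QuotientGroup.mk (β * β')) e = tw (QuotientGroup.mk β) (tw (QuotientGroup.mk β') e)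
    rw [h1, h2, h3]
  · exact key _ _ 1 e e (hrep e) ((hrep e).twist_one (OuterEquiv.of_eq (hrepS e)))

end Main

end NonabelianExt

theorem mainTheorem2 {𝕜 : Type w} [RCLike 𝕜]
    {EG : Type u} [AddCommGroup EG] [Module 𝕜 EG] [TopologicalSpace EG]
    [IsTopologicalAddGroup EG] [ContinuousSMul 𝕜 EG] [PolynormableSpace 𝕜 EG] [T2Space EG]
    {G : Type u} [Group G] [TopologicalSpace G] [ChartedSpace EG G] [LocConvLieGroup 𝕜 EG G]
    {EN : Type v} [AddCommGroup EN] [Module 𝕜 EN] [TopologicalSpace EN]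
    [IsTopologicalAddGroup EN] [ContinuousSMul 𝕜 EN] [PolynormableSpace 𝕜 EN] [T2Space EN]
    {N : Type v} [Group N] [TopologicalSpace N] [ChartedSpace EN N] [LocConvLieGroup 𝕜 EN N]
    (S : G → MulAut N) (hS : IsSmoothOuterAction 𝕜 EG EN S)
    (hne : (ExtKernel 𝕜 EG EN S).Nonempty) :
    -- every smooth factor system over the kernel `[S]` defines exactly one class `[N ×_(S',ω) G]`
    (∀ f : FactorSystem 𝕜 EG G EN N, OuterEquiv 𝕜 EG EN S f.S →
      ∃ e ∈ ExtKernel 𝕜 EG EN S, ∀ e', IsTwistedClass f e' ↔ e' = e) ∧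
    -- every class in `Ext(G, N)_[S]` is of the form `[N ×_(S,ω) G]`
    (∀ e ∈ ExtKernel 𝕜 EG EN S, ∃ f : FactorSystem 𝕜 EG G EN N, f.S = S ∧ IsTwistedClass f e) ∧
    -- `ω' ω⁻¹` is a cocycle, and it is a coboundary iff the extensions are equivalent
    (∀ f f' : FactorSystem 𝕜 EG G EN N, f.S = S → f'.S = S →
      ∃ β ∈ Z2ss 𝕜 EG EN S, (∀ p, (β p : N) = f'.ω p * (f.ω p)⁻¹) ∧
        ∀ e e', IsTwistedClass f e → IsTwistedClass f' e' → (e = e' ↔ β ∈ B2s 𝕜 EG EN S)) ∧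
    -- `[β] • [N ×_(S',ω) G] = [N ×_(S',ω·β) G]` is a well-defined simply transitive action
    ∃! act : MulAction (H2ss 𝕜 EG EN S) (ExtKernel 𝕜 EG EN S),
      (∀ (f : FactorSystem 𝕜 EG G EN N) (hf : OuterEquiv 𝕜 EG EN S f.S) (β : Z2ss 𝕜 EG EN S)
        (e e' : ExtKernel 𝕜 EG EN S), IsTwistedClass f e.1 → IsTwistedClass (f.twist hf β) e'.1 →
          act.smul (QuotientGroup.mk β) e = e') ∧
      ∀ e e' : ExtKernel 𝕜 EG EN S, ∃! b : H2ss 𝕜 EG EN S, act.smul b e = e' := by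
  refine ⟨fun f hf => ?_, fun e he => exists_factorSystem_of_mem_extKernel hS.1 he,
    fun f f' hf hf' => ?_, ?_⟩
  · obtain ⟨e, he⟩ := f.exists_isTwistedClass
    exact ⟨e, he.mem_extKernel hf, fun e' => ⟨fun h => h.of_eq he rfl fun _ => rfl,
      fun h => h ▸ he⟩⟩
  · obtain ⟨β, hβ, hβω⟩ := FactorSystem.exists_difference hf hf'
    refine ⟨β, hβ, hβω, fun e e' he he' => ?_⟩
    -- Both classes are viewed as twists of `f`: `e` by the trivial cocycle and `e'` by `β`.
    have h := he.twist_eq_iff he (he.twist_one (OuterEquiv.of_eq hf))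
      (he'.twist_of_eq_mul (β := ⟨β, hβ⟩) (hf.trans hf'.symm) (OuterEquiv.of_eq hf) hβω)
    rw [h, QuotientGroup.eq, inv_one, one_mul, Subgroup.mem_subgroupOf]
  · obtain ⟨act, hact⟩ := exists_twistAction hS.1
    refine ⟨act, ⟨hact, fun e e' => ?_⟩, fun act' hact' => MulAction.ext (funext fun b =>
      funext fun e => ?_)⟩
    · obtain ⟨f, hf, he⟩ := exists_representative hS.1 e
      obtain ⟨f', hf', he'⟩ := exists_representative hS.1 e'
      obtain ⟨β, hβ, hβω⟩ := FactorSystem.exists_difference hf hf'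
      have h := he'.twist_of_eq_mul (β := ⟨β, hβ⟩) (hf.trans hf'.symm) (OuterEquiv.of_eq hf) hβω
      refine ⟨QuotientGroup.mk ⟨β, hβ⟩, hact f _ _ _ _ he h, fun b hb => ?_⟩
      obtain ⟨γ, rfl⟩ := QuotientGroup.mk_surjective b
      obtain ⟨d, hd⟩ := exists_twist_mem f (OuterEquiv.of_eq hf) γ
      have hde : d = e' := (hact f _ _ _ _ he hd).symm.trans hb
      -- Freeness: twists of `f` by `γ` and by `β` have the same class only if `γ` and `β` are
      -- cohomologous.
      exact (he.twist_eq_iff he hd h).1 (congrArg Subtype.val hde)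
    -- Uniqueness of the action: every class has a representative, so the defining formula fixes all
    -- values.
    · obtain ⟨f, hf, he⟩ := exists_representative hS.1 e
      obtain ⟨β, rfl⟩ := QuotientGroup.mk_surjective b
      obtain ⟨d, hd⟩ := exists_twist_mem f (OuterEquiv.of_eq hf) β
      exact (hact'.1 f _ _ _ _ he hd).trans (hact f _ _ _ _ he hd).symm
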